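/- Let $M$ be a connected Riemann surface and let $y:M\to\mathbb S^3$ be a smooth conformal immersion. In a holomorphic coordinate $z=u+iv$, let $Y=(1,y)/|y_u|$ be the canonical lift of $y$ to the light cone of $\mathbb R^{4,1}$ (form $\langle Y,Y\rangle=-Y_0^2+Y_1^2+\dots+Y_4^2$), so that $|dY|^2=|dz|^2$; let $V=\mathrm{span}\{Y,\mathrm{Re}\,Y_z,\mathrm{Im}\,Y_z,Y_{z\bar z}\}$, let $N\in V$ be given by $\langle N,N\rangle=0$, $\langle N,Y\rangle=-1$, $\langle N,Y_z\rangle=0$, and let $X$ be the unit normal of $V$ for which $(Y,Y_u,Y_v,N,X)$ is positively oriented. The Schwarzian $s$ and the Hopfian $\kappa$ are the complex functions with $$Y_{zz}=-\tfrac s2\,Y+\kappa X .$$ The point $y(p)$ is umbilic iff $\kappa(p)=0$. The immersion is Willmore iff $\kappa_{\bar z\bar z}+\tfrac{\bar s}{2}\kappa=0$ in every holomorphic coordinate. If there are no umbilic points, define $\mu$ by $\kappa_{\bar z}+\tfrac{\bar\mu}{2}\kappa=0$, and put $$\rho=\bar\mu_z-2\kappa\bar\kappa,\qquad \mathcal P=\frac{\rho}{\kappa\bar\kappa},\qquad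 e^{2\omega}=4\kappa\bar\kappa,\qquad \mathcal K=-4e^{-2\omega}\omega_{z\bar z};$$ $\mathcal P:M\to\mathbb C$ and $\mathcal K:M\to\mathbb R$ do not depend on the coordinate, and $\mathcal K$ is the Gaussian curvature of the Möbius metric $4\kappa\bar\kappa\,|dz|^2$. Two such immersions $y,\tilde y:M\to\mathbb S^3$ belong to the same associated family if there is a constant $t\in\mathbb R$ such that $\tilde s=s$ and $\tilde\kappa=e^{it}\kappa$ in every holomorphic coordinate of $M$. **Proposition.** Let $y,\tilde y:M\to\mathbb S^3$ be two conformal Willmore immersions without umbilic points, and suppose that the invariants of $y$ satisfy $\mathcal P\neq0$ and $\mathcal K\neq0$ at every point of $M$. Then $\mathcal P=\widetilde{\mathcal P}$ on $M$ if and only if $y$ and $\tilde y$ belong to the same associated family. Moreover, $y$ and $\tilde y$ belong to the same associated family if and only if their Hopfians differ by a constant phase, that is, there is a constant $t\in\mathbb R$ such that $\tilde\kappa=e^{it}\kappa$ in every holomorphic coordinate. -/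

import Mathlib

open scoped Manifold ContDiff

namespace WillmoreS3

noncomputable section

/-- Euclidean 4-space. -/
abbrev E4 : Type := EuclideanSpace ℝ (Fin 4)

/-- The unit 3-sphere. -/
abbrev S3 : Type := Metric.sphere (0 : E4) 1

/-! ### Wirtinger derivatives -/

/-- `∂g/∂z = (g_u - i g_v) / 2`, where `z = u + i v`. -/
def dz (g : ℂ → ℂ) (z : ℂ) : ℂ :=
  (fderiv ℝ g z 1 - Complex.I * fderiv ℝ g z Complex.I) / 2

/-- `∂g/∂z̄ = (g_u + i g_v) / 2`, where `z = u + i v`. -/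
def dzbar (g : ℂ → ℂ) (z : ℂ) : ℂ :=
  (fderiv ℝ g z 1 + Complex.I * fderiv ℝ g z Complex.I) / 2

/-- Componentwise `∂/∂z` of a map into `ℂ⁵`. -/
def vdz (G : ℂ → Fin 5 → ℂ) (z : ℂ) : Fin 5 → ℂ := fun i => dz (fun w => G w i) z

/-- Componentwise `∂/∂z̄` of a map into `ℂ⁵`. -/
def vdzbar (G : ℂ → Fin 5 → ℂ) (z : ℂ) : Fin 5 → ℂ := fun i => dzbar (fun w => G w i) z

/-! ### The complexified Minkowski space `ℝ^{4,1} ⊗ ℂ` -/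

/-- The complex bilinear extension of the Lorentz form `-Y₀² + Y₁² + ⋯ + Y₄²`. -/
def mink (v w : Fin 5 → ℂ) : ℂ := -(v 0 * w 0) + ∑ i : Fin 4, v i.succ * w i.succ

/-- The Lorentzian cross product of four vectors of `ℝ^{4,1} ⊗ ℂ`: the vector `X` with
`⟨X, v⟩ = det (a, b, c, d, v)` for all `v` (see `mink_cross`). -/
def cross (a b c d : Fin 5 → ℂ) : Fin 5 → ℂ := fun i =>
  (if i = 0 then -1 else 1) * Matrix.det ![a, b, c, d, Pi.single i 1]

theorem mink_cross (a b c d v : Fin 5 → ℂ) :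
    mink (cross a b c d) v = Matrix.det ![a, b, c, d, v] := by
  obtain ⟨L, hL⟩ : ∃ L : (Fin 5 → ℂ) →ₗ[ℂ] ℂ, ∀ w, Matrix.det ![a, b, c, d, w] = L w := by
    let A : Matrix (Fin 5) (Fin 5) ℂ := ![a, b, c, d, 0]
    have h : ∀ w : Fin 5 → ℂ, ![a, b, c, d, w] = A.updateRow 4 w := by
      intro w
      funext i
      fin_cases i <;> rfl
    have hA : IsLinearMap ℂ fun w : Fin 5 → ℂ => (A.updateRow 4 w).det :=
      { map_add := fun u w => by rw [Matrix.det_updateRow_add]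
        map_smul := fun r w => by rw [Matrix.det_updateRow_smul, smul_eq_mul] }
    exact ⟨hA.mk' _, fun w => by rw [h w, IsLinearMap.mk'_apply]⟩
  have hv : v = ∑ i, v i • (Pi.single i 1 : Fin 5 → ℂ) := by
    funext j
    simp [Finset.sum_apply, Pi.single_apply]
  have hLv : L v = ∑ i, v i * L (Pi.single i 1) := by
    conv_lhs => rw [hv]
    rw [map_sum]
    exact Finset.sum_congr rfl fun i _ => by rw [map_smul, smul_eq_mul]
  rw [hL, hLv, Fin.sum_univ_succ]
  simp only [mink, cross, hL, Fin.succ_ne_zero, if_true, if_false]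
  congr 1
  · ring
  · exact Finset.sum_congr rfl fun i _ => by ring

/-! ### Conformal invariants in a coordinate

Throughout, `f` is a map from (an open subset of) the `z`-plane to `ℝ⁴`, with values in the unit
sphere and conformal for the coordinate `z = u + i v`. -/

/-- The canonical lift `Y = (1, f) / |f_u|` to the light cone: `|dY|² = |dz|²`, since
`|d(λ (1, f))|² = λ² |df|² = λ² |f_u|² |dz|²`. -/
def canonicalLift (f : ℂ → E4) (z : ℂ) : Fin 5 → ℂ := fun i =>
  ((‖fderiv ℝ f z 1‖⁻¹ * (Fin.cons 1 (fun j : Fin 4 => f z j) : Fin 5 → ℝ) i : ℝ) : ℂ)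

/-- `Y_z`. -/
def liftZ (f : ℂ → E4) : ℂ → Fin 5 → ℂ := vdz (canonicalLift f)

/-- `Y_{z̄}`. -/
def liftZbar (f : ℂ → E4) : ℂ → Fin 5 → ℂ := vdzbar (canonicalLift f)

/-- `Y_{zz}`. -/
def liftZZ (f : ℂ → E4) : ℂ → Fin 5 → ℂ := vdz (liftZ f)

/-- `Y_{z z̄}`. -/
def liftZZbar (f : ℂ → E4) : ℂ → Fin 5 → ℂ := vdzbar (liftZ f)

/-- The frame vector `N ∈ V = span {Y, Re Y_z, Im Y_z, Y_{z z̄}}` which is determined by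
`⟨N, N⟩ = 0`, `⟨N, Y⟩ = -1`, `⟨N, Y_z⟩ = 0`. As `⟨Y_{z z̄}, Y⟩ = -1/2`, `⟨Y_{z z̄}, Y_z⟩ = 0`, it is
`N = 2 Y_{z z̄} + 2 ⟨Y_{z z̄}, Y_{z z̄}⟩ Y`. -/
def frameN (f : ℂ → E4) (z : ℂ) : Fin 5 → ℂ :=
  (2 : ℂ) • liftZZbar f z
    + (2 * mink (liftZZbar f z) (liftZZbar f z)) • canonicalLift f z

/-- The conformal Gauss map: the unit normal `X` of `V = span {Y, Y_u, Y_v, N}` for which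
`(Y, Y_u, Y_v, N, X)` is positively oriented; here `Y_u = Y_z + Y_{z̄}`, `Y_v = i (Y_z - Y_{z̄})`.
The Gram determinant of `(Y, Y_u, Y_v, N)` is `-1`, so the cross product is of length `1`. -/
def gaussMap (f : ℂ → E4) (z : ℂ) : Fin 5 → ℂ :=
  cross (canonicalLift f z) (liftZ f z + liftZbar f z)
    (Complex.I • (liftZ f z - liftZbar f z)) (frameN f z)

/-- The Schwarzian `s`: minus twice the `Y`-component of `Y_{zz}` in `V ⊕ V^⊥`, that is,
`Y_{zz} = -(s/2) Y + κ X`. It is read off by `⟨Y, N⟩ = -1`, `⟨X, N⟩ = 0`. -/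
def schwarzian (f : ℂ → E4) (z : ℂ) : ℂ := 2 * mink (liftZZ f z) (frameN f z)

/-- The (scalar) Hopfian `κ`, defined by `Y_{zz} + (s/2) Y = κ X`. -/
def hopfian (f : ℂ → E4) (z : ℂ) : ℂ :=
  mink (liftZZ f z + (schwarzian f z / 2) • canonicalLift f z) (gaussMap f z)

/-- The function `μ` determined by `κ_{z̄} + (μ̄/2) κ = 0` (away from umbilic points). -/
def mu (f : ℂ → E4) (z : ℂ) : ℂ :=
  starRingEnd ℂ (-2 * dzbar (hopfian f) z / hopfian f z)

/-- `ρ = (μ̄)_z - 2 κ κ̄`. -/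
def rho (f : ℂ → E4) (z : ℂ) : ℂ :=
  dz (fun w => starRingEnd ℂ (mu f w)) z - 2 * (hopfian f z * starRingEnd ℂ (hopfian f z))

/-- `𝒫 = ρ / (κ κ̄)`. -/
def coordP (f : ℂ → E4) (z : ℂ) : ℂ :=
  rho f z / (hopfian f z * starRingEnd ℂ (hopfian f z))

/-- The function `ω` in the Möbius metric `e^{2ω} |dz|² = 4 κ κ̄ |dz|²`. -/
def logFactor (f : ℂ → E4) (z : ℂ) : ℝ := Real.log (4 * ‖hopfian f z‖ ^ 2) / 2

/-- The Möbius curvature `𝒦 = -4 e^{-2ω} ω_{z z̄}`, the Gaussian curvature of the Möbius metric. -/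
def coordK (f : ℂ → E4) (z : ℂ) : ℝ :=
  -4 * Real.exp (-2 * logFactor f z) * (dzbar (dz fun w => (logFactor f w : ℂ)) z).re

/-! ### Surfaces in the 3-sphere -/

section Surfaces

variable {M : Type*} [TopologicalSpace M] [ChartedSpace ℂ M]

/-- The holomorphic coordinates of the Riemann surface `M`. -/
def holoCharts (M : Type*) [TopologicalSpace M] [ChartedSpace ℂ M] :
    Set (OpenPartialHomeomorph M ℂ) :=
  IsManifold.maximalAtlas 𝓘(ℂ) ω M

/-- The expression of `y : M → S³` in a coordinate, as an `ℝ⁴`-valued map. -/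
def inCoord (y : M → S3) (e : OpenPartialHomeomorph M ℂ) (z : ℂ) : E4 := (y (e.symm z) : E4)

/-- `y` is a smooth conformal immersion: in every holomorphic coordinate it is smooth, and its
differential is everywhere a nonzero multiple of a linear isometry. -/
structure IsConformalImmersion (y : M → S3) : Prop where
  smooth : ∀ e ∈ holoCharts M, ContDiffOn ℝ ∞ (inCoord y e) e.target
  conformal : ∀ e ∈ holoCharts M, ∀ z ∈ e.target, ConformalAt (inCoord y e) z

/-- `y` has no umbilic points. -/
def UmbilicFree (y : M → S3) : Prop :=
  ∀ e ∈ holoCharts M, ∀ z ∈ e.target, hopfian (inCoord y e) z ≠ 0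

/-- `y` is a Willmore surface: `κ_{z̄ z̄} + (s̄/2) κ = 0` in every holomorphic coordinate. -/
def IsWillmore (y : M → S3) : Prop :=
  ∀ e ∈ holoCharts M, ∀ z ∈ e.target,
    dzbar (dzbar (hopfian (inCoord y e))) z
      + starRingEnd ℂ (schwarzian (inCoord y e) z) / 2 * hopfian (inCoord y e) z = 0

/-- The function `𝒫 : M → ℂ`, computed at `p` in a coordinate around `p` (the value does not depend
on the coordinate). -/
def invP (y : M → S3) (p : M) : ℂ := coordP (inCoord y (chartAt ℂ p)) (chartAt ℂ p p)

/-- The Möbius curvature `𝒦 : M → ℝ`, computed at `p` in a coordinate around `p` (the value does not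
depend on the coordinate). -/
def moebiusCurvature (y : M → S3) (p : M) : ℝ :=
  coordK (inCoord y (chartAt ℂ p)) (chartAt ℂ p p)

/-- The Hopfians of `y` and `y'` differ by a constant phase `e^{it}`. -/
def HopfiansDifferByPhase (y y' : M → S3) : Prop :=
  ∃ t : ℝ, ∀ e ∈ holoCharts M, ∀ z ∈ e.target,
    hopfian (inCoord y' e) z = Complex.exp (Complex.I * t) * hopfian (inCoord y e) z

/-- `y'` belongs to the associated family of `y`: if `y` has the data `{s, κ}`, then `y'` has the
data `{s, e^{it} κ}` for some real constant `t`. -/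
def SameAssociatedFamily (y y' : M → S3) : Prop :=
  ∃ t : ℝ, ∀ e ∈ holoCharts M, ∀ z ∈ e.target,
    schwarzian (inCoord y' e) z = schwarzian (inCoord y e) z ∧
    hopfian (inCoord y' e) z = Complex.exp (Complex.I * t) * hopfian (inCoord y e) z

end Surfaces

end

end WillmoreS3

namespace WillmoreS3

/-! ### Wirtinger calculus -/

section Wirtinger

open scoped ComplexConjugate

variable {g h : ℂ → ℂ} {z : ℂ} {U : Set ℂ}

/-! In a coordinate put `q = κ_z̄/κ` and `r = κ_z/κ`, so that `r_z̄ = q_z`, `μ̄ = -2q` and `ρ = -2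
q_z - 2|κ|²`. Write `q̃`, `r̃`, `κ̃`, `ρ̃` for the data of the second surface.

The Willmore equation is the Riccati equation `q_z̄ = -s̄/2 - q²`. Differentiated in `z` and
combined with the conjugate of the Gauss equation `s_z̄ = 2(|κ|²)_z + 4κ κ̄_z`, it loses the
Schwarzian and becomes `ρ_z̄ = -2qρ` (`IsConformalChart.dzbar_rho`). In addition `𝒦 = 1 + Re 𝒫 / 2`
(`IsConformalChart.coordK_eq`).

Suppose both surfaces have the same `𝒫 ≠ 0`. The logarithmic `z̄`-derivative of `ρ/|κ|² = ρ̃/|κ̃|²`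
gives `r̃ - r = -3 conj(q̃ - q)`. One more `z̄`-derivative shows that `x = q̃_z - q_z` satisfies `x
= -3x̄`, whence `x = 0`. Now `(𝒫 + 2)|κ|² = -2q_z` is the same for both surfaces, and `𝒦 ≠ 0`
excludes `𝒫 = -2`; thus `|κ̃| = |κ|`. The `z`-derivative of this equality, compared with the first
relation, forces `q̃ = q` and `r̃ = r`. So `κ̃/κ` is locally a constant of modulus one
(`IsConformalChart.hopfian_ratio`). The ratio does not depend on the coordinate, and connectedness
of `M` makes it a global constant.

Conversely, a constant phase changes neither `q` nor `|κ|²`, hence not `𝒫`, and the Willmore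
equation recovers `s` from `κ` away from umbilics.

The structure equations are obtained without expanding derivatives in a moving frame: the component
along `X` is a determinant, and a Gram determinant identity converts products of two such components
into Lorentz products of derivatives of `Y`. -/

theorem dz_congr (hgh : g =ᶠ[nhds z] h) : dz g z = dz h z := by
  simp only [dz, hgh.fderiv_eq]

theorem dzbar_congr (hgh : g =ᶠ[nhds z] h) : dzbar g z = dzbar h z := by
  simp only [dzbar, hgh.fderiv_eq]

theorem dz_congr_on (hU : IsOpen U) (hgh : Set.EqOn g h U) : Set.EqOn (dz g) (dz h) U :=
  fun _ hz => dz_congr (Filter.eventuallyEq_of_mem (hU.mem_nhds hz) hgh)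

theorem dzbar_congr_on (hU : IsOpen U) (hgh : Set.EqOn g h U) :
    Set.EqOn (dzbar g) (dzbar h) U :=
  fun _ hz => dzbar_congr (Filter.eventuallyEq_of_mem (hU.mem_nhds hz) hgh)

@[simp] theorem dz_const (c : ℂ) : dz (fun _ => c) z = 0 := by
  simp [dz]

@[simp] theorem dzbar_const (c : ℂ) : dzbar (fun _ => c) z = 0 := by
  simp [dzbar]

theorem dz_add (hg : DifferentiableAt ℝ g z) (hh : DifferentiableAt ℝ h z) :
    dz (fun w => g w + h w) z = dz g z + dz h z := by
  simp only [dz, fderiv_fun_add hg hh, add_apply]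
  ring

theorem dzbar_add (hg : DifferentiableAt ℝ g z) (hh : DifferentiableAt ℝ h z) :
    dzbar (fun w => g w + h w) z = dzbar g z + dzbar h z := by
  simp only [dzbar, fderiv_fun_add hg hh, add_apply]
  ring

theorem dz_mul (hg : DifferentiableAt ℝ g z) (hh : DifferentiableAt ℝ h z) :
    dz (fun w => g w * h w) z = dz g z * h z + g z * dz h z := by
  simp only [dz, fderiv_fun_mul hg hh, add_apply,
    smul_apply, smul_eq_mul]
  ring

theorem dzbar_mul (hg : DifferentiableAt ℝ g z) (hh : DifferentiableAt ℝ h z) :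
    dzbar (fun w => g w * h w) z = dzbar g z * h z + g z * dzbar h z := by
  simp only [dzbar, fderiv_fun_mul hg hh, add_apply,
    smul_apply, smul_eq_mul]
  ring

theorem dz_const_mul (c : ℂ) (hg : DifferentiableAt ℝ g z) :
    dz (fun w => c * g w) z = c * dz g z := by
  rw [dz_mul (differentiableAt_const c) hg, dz_const]; ring

theorem dzbar_const_mul (c : ℂ) (hg : DifferentiableAt ℝ g z) :
    dzbar (fun w => c * g w) z = c * dzbar g z := by
  rw [dzbar_mul (differentiableAt_const c) hg, dzbar_const]; ring

theorem fderiv_conj (hg : DifferentiableAt ℝ g z) (v : ℂ) :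
    fderiv ℝ (fun w => conj (g w)) z v = conj (fderiv ℝ g z v) := by
  have := (Complex.conjCLE.toContinuousLinearMap.hasFDerivAt.comp z hg.hasFDerivAt).fderiv
  have h2 : (fun w => conj (g w)) = (Complex.conjCLE.toContinuousLinearMap ∘ g) := rfl
  rw [h2, this]
  simp

theorem dz_conj (hg : DifferentiableAt ℝ g z) :
    dz (fun w => conj (g w)) z = conj (dzbar g z) := by
  simp only [dz, dzbar, fderiv_conj hg, map_div₀, map_add, map_mul, Complex.conj_I, map_ofNat]
  ring

theorem dzbar_conj (hg : DifferentiableAt ℝ g z) :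
    dzbar (fun w => conj (g w)) z = conj (dz g z) := by
  simp only [dz, dzbar, fderiv_conj hg, map_div₀, map_sub, map_mul, Complex.conj_I, map_ofNat]
  ring

theorem dz_div (hg : DifferentiableAt ℝ g z) (hh : DifferentiableAt ℝ h z) (h0 : h z ≠ 0) :
    dz (fun w => g w / h w) z = (dz g z * h z - g z * dz h z) / h z ^ 2 := by
  have hd : DifferentiableAt ℝ (fun w => g w / h w) z := by
    simp only [div_eq_mul_inv]
    exact hg.fun_mul (hh.inv h0)
  -- The product rule for `(g / h) * h = g` is solved for the derivative of the quotient.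
  have e := dz_mul hd hh
  have hne : ∀ᶠ w in nhds z, h w ≠ 0 := hh.continuousAt.eventually_ne h0
  rw [dz_congr (h := g) (hne.mono fun w hw => div_mul_cancel₀ _ hw)] at e
  rw [e]
  field_simp
  ring

theorem dzbar_div (hg : DifferentiableAt ℝ g z) (hh : DifferentiableAt ℝ h z) (h0 : h z ≠ 0) :
    dzbar (fun w => g w / h w) z = (dzbar g z * h z - g z * dzbar h z) / h z ^ 2 := by
  have hd : DifferentiableAt ℝ (fun w => g w / h w) z := by
    simp only [div_eq_mul_inv]
    exact hg.fun_mul (hh.inv h0)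
  have e := dzbar_mul hd hh
  have hne : ∀ᶠ w in nhds z, h w ≠ 0 := hh.continuousAt.eventually_ne h0
  rw [dzbar_congr (h := g) (hne.mono fun w hw => div_mul_cancel₀ _ hw)] at e
  rw [e]
  field_simp
  ring

theorem fderiv_eq_zero_of_wirtinger (h1 : dz g z = 0) (h2 : dzbar g z = 0) :
    fderiv ℝ g z = 0 := by
  have e1 : fderiv ℝ g z 1 = 0 := by
    have : fderiv ℝ g z 1 = dz g z + dzbar g z := by simp only [dz, dzbar]; ring
    rw [this, h1, h2, add_zero]
  have e2 : fderiv ℝ g z Complex.I = 0 := by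
    have : fderiv ℝ g z Complex.I = Complex.I * (dz g z - dzbar g z) := by
      simp only [dz, dzbar]; linear_combination (fderiv ℝ g z Complex.I) * Complex.I_sq
    rw [this, h1, h2, sub_zero, mul_zero]
  ext v
  have hv : v = v.re • (1 : ℂ) + v.im • Complex.I := by
    simp [Complex.re_add_im]
  rw [hv, map_add, map_smul, map_smul, e1, e2]
  simp

theorem differentiableAt_of_smooth (hU : IsOpen U) {F : Type*} [NormedAddCommGroup F]
    [NormedSpace ℝ F] {g : ℂ → F} (hg : ContDiffOn ℝ ∞ g U) (hz : z ∈ U) :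
    DifferentiableAt ℝ g z :=
  (hg.contDiffAt (hU.mem_nhds hz)).differentiableAt (by simp)

theorem smooth_fderiv_apply (hU : IsOpen U) {F : Type*} [NormedAddCommGroup F]
    [NormedSpace ℝ F] {g : ℂ → F} (hg : ContDiffOn ℝ ∞ g U) (v : ℂ) :
    ContDiffOn ℝ ∞ (fun w => fderiv ℝ g w v) U :=
  (hg.fderiv_of_isOpen hU (m := ∞) (by simp)).clm_apply contDiffOn_const

theorem smooth_dz (hU : IsOpen U) (hg : ContDiffOn ℝ ∞ g U) : ContDiffOn ℝ ∞ (dz g) U :=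
  ((smooth_fderiv_apply hU hg 1).sub
    (contDiffOn_const.mul (smooth_fderiv_apply hU hg Complex.I))).div_const 2

theorem smooth_dzbar (hU : IsOpen U) (hg : ContDiffOn ℝ ∞ g U) : ContDiffOn ℝ ∞ (dzbar g) U :=
  ((smooth_fderiv_apply hU hg 1).add
    (contDiffOn_const.mul (smooth_fderiv_apply hU hg Complex.I))).div_const 2

theorem smooth_conj (hg : ContDiffOn ℝ ∞ g U) : ContDiffOn ℝ ∞ (fun w => conj (g w)) U :=
  Complex.conjCLE.contDiff.comp_contDiffOn hg

theorem fderiv_fderiv_apply (hU : IsOpen U) (hg : ContDiffOn ℝ ∞ g U) (hz : z ∈ U) (v w : ℂ) :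
    fderiv ℝ (fun x => fderiv ℝ g x v) z w = fderiv ℝ (fderiv ℝ g) z w v := by
  have hd : DifferentiableAt ℝ (fderiv ℝ g) z :=
    differentiableAt_of_smooth hU (hg.fderiv_of_isOpen hU (m := ∞) (by simp)) hz
  rw [fderiv_clm_apply hd (differentiableAt_const v)]
  simp

/-- Both sides are a quarter of the Laplacian, because the mixed second derivatives cancel by
symmetry. -/
theorem dz_dzbar_comm (hU : IsOpen U) (hg : ContDiffOn ℝ ∞ g U) (hz : z ∈ U) :
    dz (dzbar g) z = dzbar (dz g) z := by
  have hs : IsSymmSndFDerivAt ℝ g z :=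
    (hg.contDiffAt (hU.mem_nhds hz)).isSymmSndFDerivAt (by
      rw [minSmoothness_of_isRCLikeNormedField]; exact ENat.LEInfty.out)
  have d1 := differentiableAt_of_smooth hU (smooth_fderiv_apply hU hg 1) hz
  have d2 := differentiableAt_of_smooth hU (smooth_fderiv_apply hU hg Complex.I) hz
  have d3 : DifferentiableAt ℝ (fun x => Complex.I * fderiv ℝ g x Complex.I) z :=
    (differentiableAt_const _).mul d2
  have e1 : ∀ v, fderiv ℝ (dzbar g) z v
      = (fderiv ℝ (fderiv ℝ g) z v 1 + Complex.I * fderiv ℝ (fderiv ℝ g) z v Complex.I) / 2 := by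
    intro v
    have : dzbar g = fun x =>
        (2⁻¹ : ℂ) * (fderiv ℝ g x 1 + Complex.I * fderiv ℝ g x Complex.I) := by
      funext x; simp only [dzbar]; ring
    rw [this, fderiv_const_mul (d1.fun_add d3), fderiv_fun_add d1 d3, fderiv_const_mul d2]
    simp [fderiv_fderiv_apply hU hg hz]
    ring
  have e2 : ∀ v, fderiv ℝ (dz g) z v
      = (fderiv ℝ (fderiv ℝ g) z v 1 - Complex.I * fderiv ℝ (fderiv ℝ g) z v Complex.I) / 2 := by
    intro v
    have : dz g = fun x => (2⁻¹ : ℂ) * (fderiv ℝ g x 1 - Complex.I * fderiv ℝ g x Complex.I) := by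
      funext x; simp only [dz]; ring
    rw [this, fderiv_const_mul (d1.fun_sub d3), fderiv_fun_sub d1 d3, fderiv_const_mul d2]
    simp [fderiv_fderiv_apply hU hg hz]
    ring
  rw [dz, dzbar, e1, e1, e2, e2, hs.eq 1 Complex.I]
  ring

theorem fderiv_real_of_complex {φ : ℂ → ℂ} (hφ : DifferentiableAt ℂ φ z) (v : ℂ) :
    fderiv ℝ φ z v = deriv φ z * v := by
  rw [(hφ.hasFDerivAt.restrictScalars ℝ).fderiv]
  simp [mul_comm]

theorem dz_holomorphic {φ : ℂ → ℂ} (hφ : DifferentiableAt ℂ φ z) : dz φ z = deriv φ z := by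
  simp only [dz, fderiv_real_of_complex hφ]
  linear_combination (-deriv φ z / 2) * Complex.I_sq

theorem dzbar_holomorphic {φ : ℂ → ℂ} (hφ : DifferentiableAt ℂ φ z) : dzbar φ z = 0 := by
  simp only [dzbar, fderiv_real_of_complex hφ]
  linear_combination (deriv φ z / 2) * Complex.I_sq

theorem fderiv_comp_holomorphic {F : Type*} [NormedAddCommGroup F] [NormedSpace ℝ F]
    {g : ℂ → F} {φ : ℂ → ℂ} (hφ : DifferentiableAt ℂ φ z)
    (hg : DifferentiableAt ℝ g (φ z)) (v : ℂ) :
    fderiv ℝ (fun w => g (φ w)) z v = fderiv ℝ g (φ z) (deriv φ z * v) := by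
  have := fderiv_comp z hg (hφ.restrictScalars ℝ)
  rw [show (fun w => g (φ w)) = g ∘ φ from rfl, this, ContinuousLinearMap.comp_apply,
    fderiv_real_of_complex hφ]

theorem fderiv_apply_eq (L : ℂ →L[ℝ] ℂ) (c : ℂ) :
    L c = c.re * L 1 + c.im * L Complex.I := by
  have hc : c = c.re • (1 : ℂ) + c.im • Complex.I := by simp [Complex.re_add_im]
  conv_lhs => rw [hc]
  rw [map_add, map_smul, map_smul, Complex.real_smul, Complex.real_smul]

theorem dz_comp {φ : ℂ → ℂ} (hφ : DifferentiableAt ℂ φ z) (hg : DifferentiableAt ℝ g (φ z)) :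
    dz (fun w => g (φ w)) z = deriv φ z * dz g (φ z) := by
  simp only [dz, fderiv_comp_holomorphic hφ hg]
  rw [fderiv_apply_eq _ (deriv φ z * 1), fderiv_apply_eq _ (deriv φ z * Complex.I)]
  have hc := Complex.re_add_im (deriv φ z)
  simp only [mul_one, Complex.mul_re, Complex.mul_im, Complex.I_re, Complex.I_im]
  push_cast
  linear_combination ((fderiv ℝ g (φ z) 1 - Complex.I * fderiv ℝ g (φ z) Complex.I) / 2) * hc
    + ((deriv φ z).im * fderiv ℝ g (φ z) Complex.I / 2) * Complex.I_sq

theorem dzbar_comp {φ : ℂ → ℂ} (hφ : DifferentiableAt ℂ φ z)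
    (hg : DifferentiableAt ℝ g (φ z)) :
    dzbar (fun w => g (φ w)) z = conj (deriv φ z) * dzbar g (φ z) := by
  simp only [dzbar, fderiv_comp_holomorphic hφ hg]
  rw [fderiv_apply_eq _ (deriv φ z * 1), fderiv_apply_eq _ (deriv φ z * Complex.I)]
  have hc : ((deriv φ z).re : ℂ) - (deriv φ z).im * Complex.I = conj (deriv φ z) := by
    apply Complex.ext <;> simp
  simp only [mul_one, Complex.mul_re, Complex.mul_im, Complex.I_re, Complex.I_im]
  push_cast
  linear_combination ((fderiv ℝ g (φ z) 1 + Complex.I * fderiv ℝ g (φ z) Complex.I) / 2) * hc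
    + ((deriv φ z).im * fderiv ℝ g (φ z) Complex.I / 2) * Complex.I_sq

theorem smooth_of_holomorphic (hU : IsOpen U) {φ : ℂ → ℂ} (hφ : DifferentiableOn ℂ φ U) :
    ContDiffOn ℝ ∞ φ U :=
  (hφ.contDiffOn hU).restrict_scalars ℝ

end Wirtinger

/-! ### Linear algebra of the Lorentz form -/

section Lorentz

open scoped ComplexConjugate

variable (a b c d v w : Fin 5 → ℂ)

theorem mink_comm : mink v w = mink w v := by
  simp only [mink, mul_comm]

theorem mink_add_left : mink (a + b) w = mink a w + mink b w := by
  simp only [mink, Fin.sum_univ_four, Pi.add_apply]; ring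

theorem mink_smul_left (r : ℂ) : mink (r • a) w = r * mink a w := by
  simp only [mink, Fin.sum_univ_four, Pi.smul_apply, smul_eq_mul]; ring

theorem mink_add_right : mink w (a + b) = mink w a + mink w b := by
  rw [mink_comm, mink_add_left, mink_comm a, mink_comm b]

theorem mink_smul_right (r : ℂ) : mink w (r • a) = r * mink w a := by
  rw [mink_comm, mink_smul_left, mink_comm a]

theorem mink_conj : mink (fun i => conj (v i)) (fun i => conj (w i)) = conj (mink v w) := by
  simp [mink]

/-- The Gram determinant of two quintuples of vectors. -/
theorem det_mul_det_eq_neg_gram (A B : Fin 5 → Fin 5 → ℂ) :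
    (Matrix.of A).det * (Matrix.of B).det = -(Matrix.of fun i j => mink (A i) (B j)).det := by
  let J : Matrix (Fin 5) (Fin 5) ℂ := Matrix.diagonal ![-1, 1, 1, 1, 1]
  have h : (Matrix.of fun i j => mink (A i) (B j))
      = Matrix.of A * J * (Matrix.of B).transpose := by
    ext i j
    simp [J, Matrix.mul_apply, mink, Fin.sum_univ_succ]
  rw [h, Matrix.det_mul, Matrix.det_mul, Matrix.det_transpose, Matrix.det_diagonal]
  simp [Fin.prod_univ_succ]

/-- The determinant of five vectors. -/
noncomputable def frameDet (a b c d v : Fin 5 → ℂ) : ℂ := (Matrix.of ![a, b, c, d, v]).det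

theorem mink_cross_eq_frameDet : mink (cross a b c d) v = frameDet a b c d v :=
  mink_cross a b c d v

/-- Multiplicativity of the determinant. Changes of frame are handled through the explicit matrix
`T`, so the components of the vectors never have to be expanded. -/
theorem frameDet_eq_of_combination {a b c d v a' b' c' d' v' : Fin 5 → ℂ}
    (T : Matrix (Fin 5) (Fin 5) ℂ) (h : ∀ i j, (Matrix.of ![a', b', c', d', v']) i j
      = ∑ k, T i k * (Matrix.of ![a, b, c, d, v]) k j) :
    frameDet a' b' c' d' v' = T.det * frameDet a b c d v := by
  rw [frameDet, frameDet, ← Matrix.det_mul]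
  congr 1
  ext i j
  rw [h, Matrix.mul_apply]

/-- Expressing the frame `Y, Y_u, Y_v, N` of the conformal Gauss map through derivatives. -/
theorem frameDet_frame (c : ℂ) :
    frameDet v (a + b) (Complex.I • (a - b)) ((2 : ℂ) • d + c • v) w
      = -4 * Complex.I * frameDet v a b d w := by
  rw [frameDet_eq_of_combination
    (a := v) (b := a) (c := b) (d := d) (v := w) !![1, 0, 0, 0, 0; 0, 1, 1, 0, 0;
        0, Complex.I, -Complex.I, 0, 0; c, 0, 0, 2, 0; 0, 0, 0, 0, 1]]
  · congr 1
    simp [Matrix.det_succ_row_zero, Fin.sum_univ_succ]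
    simp [Fin.succAbove, Fin.lt_def]
    ring
  · intro i j
    fin_cases i <;> simp [Fin.sum_univ_succ] <;> try ring

/-- Removes the term `(s/2) Y` from the definition of the Hopfian, `Y` being the first row. -/
theorem frameDet_add_smul_last (r : ℂ) :
    frameDet v a b d (w + r • v) = frameDet v a b d w := by
  rw [frameDet_eq_of_combination
    (a := v) (b := a) (c := b) (d := d) (v := w) !![1, 0, 0, 0, 0; 0, 1, 0, 0, 0; 0, 0, 1, 0, 0;
      0, 0, 0, 1, 0; r, 0, 0, 0, 1]]
  · simp [Matrix.det_succ_row_zero, Fin.sum_univ_succ]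
  · intro i j
    fin_cases i <;> simp [Fin.sum_univ_succ]
    ring

/-- A vector orthogonal to a frame with the Gram matrix of `Y, Y_z, Y_z̄, Y_{z z̄}` is recovered
from determinants. -/
theorem mink_eq_det_mul_det {Y a b d v w : Fin 5 → ℂ} (hYY : mink Y Y = 0) (hYa : mink Y a = 0)
    (hYb : mink Y b = 0) (haa : mink a a = 0) (hbb : mink b b = 0) (hab : mink a b = 1 / 2)
    (hdY : mink d Y = -1 / 2) (hda : mink d a = 0) (hdb : mink d b = 0)
    (hwY : mink Y w = 0) (hwa : mink a w = 0) (hwb : mink b w = 0) (hwd : mink d w = 0) :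
    mink v w = (-4 * Complex.I * frameDet Y a b d v)
      * (-4 * Complex.I * frameDet Y a b d w) := by
  have h := det_mul_det_eq_neg_gram ![Y, a, b, d, v] ![Y, a, b, d, w]
  -- The last column of the Gram matrix vanishes except for `⟨v, w⟩`, and the block of `Y, Y_z,
  -- Y_z̄, Y_{z z̄}` has determinant `1/16` whatever `⟨d, d⟩` is. The factor `-16 = (-4i)²` then
  -- absorbs both the `1/16` and the Lorentzian sign.
  have h2 : (Matrix.of fun i j => mink ((![Y, a, b, d, v] : Fin 5 → Fin 5 → ℂ) i)
      ((![Y, a, b, d, w] : Fin 5 → Fin 5 → ℂ) j)).det = mink v w / 16 := by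
    have : (Matrix.of fun i j => mink ((![Y, a, b, d, v] : Fin 5 → Fin 5 → ℂ) i)
      ((![Y, a, b, d, w] : Fin 5 → Fin 5 → ℂ) j)) =
      !![0, 0, 0, -1 / 2, 0; 0, 0, 1 / 2, 0, 0; 0, 1 / 2, 0, 0, 0; -1 / 2, 0, 0, mink d d, 0;
        mink v Y, mink v a, mink v b, mink v d, mink v w] := by
      ext i j
      fin_cases i <;> fin_cases j <;>
        simp [hYY, hYa, hYb, haa, hbb, hab, hdY, hda, hdb, hwY, hwa, hwb, hwd, mink_comm a Y,
          mink_comm b Y, mink_comm b a, mink_comm Y d, mink_comm a d, mink_comm b d]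
    rw [this]
    simp [Matrix.det_succ_row_zero, Fin.sum_univ_succ]
    simp [Fin.succAbove, Fin.lt_def]
    ring
  rw [h2] at h
  change frameDet Y a b d v * frameDet Y a b d w = _ at h
  linear_combination 16 * h + (-16) * frameDet Y a b d v * frameDet Y a b d w
    * Complex.I_sq

theorem frameDet_conj : frameDet (fun i => conj (a i)) (fun i => conj (b i))
    (fun i => conj (c i)) (fun i => conj (d i)) (fun i => conj (v i))
    = conj (frameDet a b c d v) := by
  rw [frameDet, frameDet, RingHom.map_det]
  congr 1
  ext i j
  fin_cases i <;> simp

/-- Needed for complex conjugation, which exchanges the rows `Y_z` and `Y_z̄`. -/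
theorem frameDet_swap_middle : frameDet a c b d v = -frameDet a b c d v := by
  rw [frameDet_eq_of_combination
    (a := a) (b := b) (c := c) (d := d) (v := v) !![1, 0, 0, 0, 0; 0, 0, 1, 0, 0; 0, 1, 0, 0, 0;
      0, 0, 0, 1, 0; 0, 0, 0, 0, 1]]
  · simp [Matrix.det_succ_row_zero, Fin.sum_univ_succ]
    simp [Fin.succAbove, Fin.lt_def]
  · intro i j
    fin_cases i <;> simp [Fin.sum_univ_succ]

end Lorentz

/-! ### Structure equations in a coordinate -/

section VectorCalculus

open scoped ComplexConjugate

variable {G H : ℂ → Fin 5 → ℂ} {z : ℂ} {U : Set ℂ}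

/-- Smoothness of a map into `ℂ⁵` on a domain, componentwise. -/
def VSmooth (G : ℂ → Fin 5 → ℂ) (U : Set ℂ) : Prop :=
  ∀ i, ContDiffOn ℝ ∞ (fun w => G w i) U

theorem VSmooth.vdz (hU : IsOpen U) (hG : VSmooth G U) : VSmooth (vdz G) U :=
  fun i => smooth_dz hU (hG i)

theorem VSmooth.vdzbar (hU : IsOpen U) (hG : VSmooth G U) : VSmooth (vdzbar G) U :=
  fun i => smooth_dzbar hU (hG i)

theorem VSmooth.mink (hG : VSmooth G U) (hH : VSmooth H U) :
    ContDiffOn ℝ ∞ (fun w => mink (G w) (H w)) U :=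
  ((hG 0).mul (hH 0)).neg.add (ContDiffOn.sum fun i _ => (hG i.succ).mul (hH i.succ))

theorem VSmooth.frameDet {a b c d v : ℂ → Fin 5 → ℂ} (ha : VSmooth a U) (hb : VSmooth b U)
    (hc : VSmooth c U) (hd : VSmooth d U) (hv : VSmooth v U) :
    ContDiffOn ℝ ∞ (fun w => frameDet (a w) (b w) (c w) (d w) (v w)) U := by
  simp only [WillmoreS3.frameDet, Matrix.det_apply']
  refine ContDiffOn.sum fun σ _ => contDiffOn_const.mul (contDiffOn_prod fun i _ => ?_)
  generalize σ i = j
  fin_cases j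
  exacts [ha i, hb i, hc i, hd i, hv i]

theorem dz_mink (hU : IsOpen U) (hG : VSmooth G U) (hH : VSmooth H U) (hz : z ∈ U) :
    dz (fun w => mink (G w) (H w)) z = mink (vdz G z) (H z) + mink (G z) (vdz H z) := by
  have dG := fun i => differentiableAt_of_smooth hU (hG i) hz
  have dH := fun i => differentiableAt_of_smooth hU (hH i) hz
  have e : (fun w => mink (G w) (H w)) = fun w => (-1) * (G w 0 * H w 0) + (G w 1 * H w 1 +
      (G w 2 * H w 2 + (G w 3 * H w 3 + G w 4 * H w 4))) := by
    funext w; simp only [mink, Fin.sum_univ_four]; simp; ring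
  have m := fun i => (dG i).fun_mul (dH i)
  rw [e, dz_add ((m 0).const_mul _) ((m 1).fun_add ((m 2).fun_add ((m 3).fun_add (m 4)))),
    dz_add (m 1) ((m 2).fun_add ((m 3).fun_add (m 4))),
    dz_add (m 2) ((m 3).fun_add (m 4)), dz_add (m 3) (m 4), dz_const_mul _ (m 0)]
  simp only [fun i => dz_mul (dG i) (dH i), mink, Fin.sum_univ_four, vdz]
  simp
  ring

theorem dzbar_mink (hU : IsOpen U) (hG : VSmooth G U) (hH : VSmooth H U) (hz : z ∈ U) :
    dzbar (fun w => mink (G w) (H w)) z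
      = mink (vdzbar G z) (H z) + mink (G z) (vdzbar H z) := by
  have dG := fun i => differentiableAt_of_smooth hU (hG i) hz
  have dH := fun i => differentiableAt_of_smooth hU (hH i) hz
  have e : (fun w => mink (G w) (H w)) = fun w => (-1) * (G w 0 * H w 0) + (G w 1 * H w 1 +
      (G w 2 * H w 2 + (G w 3 * H w 3 + G w 4 * H w 4))) := by
    funext w; simp only [mink, Fin.sum_univ_four]; simp; ring
  have m := fun i => (dG i).fun_mul (dH i)
  rw [e, dzbar_add ((m 0).const_mul _) ((m 1).fun_add ((m 2).fun_add ((m 3).fun_add (m 4)))),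
    dzbar_add (m 1) ((m 2).fun_add ((m 3).fun_add (m 4))),
    dzbar_add (m 2) ((m 3).fun_add (m 4)), dzbar_add (m 3) (m 4), dzbar_const_mul _ (m 0)]
  simp only [fun i => dzbar_mul (dG i) (dH i), mink, Fin.sum_univ_four, vdzbar]
  simp
  ring

/-- The source of the Gram matrix below: differentiating a constant product relates a new product to
ones already known. -/
theorem dz_mink_of_const (hU : IsOpen U) (hG : VSmooth G U) (hH : VSmooth H U) {c : ℂ}
    (hc : ∀ w ∈ U, mink (G w) (H w) = c) (hz : z ∈ U) :
    mink (vdz G z) (H z) + mink (G z) (vdz H z) = 0 := by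
  rw [← dz_mink hU hG hH hz, dz_congr_on hU (h := fun _ => c) hc hz, dz_const]

theorem dzbar_mink_of_const (hU : IsOpen U) (hG : VSmooth G U) (hH : VSmooth H U) {c : ℂ}
    (hc : ∀ w ∈ U, mink (G w) (H w) = c) (hz : z ∈ U) :
    mink (vdzbar G z) (H z) + mink (G z) (vdzbar H z) = 0 := by
  rw [← dzbar_mink hU hG hH hz, dzbar_congr_on hU (h := fun _ => c) hc hz, dzbar_const]

theorem vdz_vdzbar_comm (hU : IsOpen U) (hG : VSmooth G U) (hz : z ∈ U) :
    vdz (vdzbar G) z = vdzbar (vdz G) z :=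
  funext fun i => dz_dzbar_comm hU (hG i) hz

theorem vdz_congr_on (hU : IsOpen U) (h : ∀ w ∈ U, G w = H w) (hz : z ∈ U) :
    vdz G z = vdz H z :=
  funext fun i => dz_congr_on hU (fun w hw => congrFun (h w hw) i) hz

theorem vdzbar_congr_on (hU : IsOpen U) (h : ∀ w ∈ U, G w = H w) (hz : z ∈ U) :
    vdzbar G z = vdzbar H z :=
  funext fun i => dzbar_congr_on hU (fun w hw => congrFun (h w hw) i) hz

end VectorCalculus

/-! ### The canonical lift and the Gauss equation -/

section Coordinate

open scoped ComplexConjugate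

/-- `f` expresses a smooth conformal immersion into the unit sphere in a coordinate with
domain `U`. -/
structure IsConformalChart (f : ℂ → E4) (U : Set ℂ) : Prop where
  isOpen : IsOpen U
  smooth : ContDiffOn ℝ ∞ f U
  norm_eq : ∀ z, ‖f z‖ = 1
  conformal : ∀ z ∈ U, ConformalAt f z

variable {f : ℂ → E4} {U : Set ℂ} {z : ℂ}

theorem IsConformalChart.exists_inner (hf : IsConformalChart f U) (hz : z ∈ U) :
    ∃ c : ℝ, 0 < c ∧ ∀ u v : ℂ,
      inner ℝ (fderiv ℝ f z u) (fderiv ℝ f z v) = c * inner ℝ u v :=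
  (conformalAt_iff' ).1 (hf.conformal z hz)

theorem IsConformalChart.norm_fderiv_pos (hf : IsConformalChart f U) (hz : z ∈ U) :
    0 < ‖fderiv ℝ f z 1‖ := by
  obtain ⟨c, hc, h⟩ := hf.exists_inner hz
  have := h 1 1
  rw [real_inner_self_eq_norm_sq, real_inner_self_eq_norm_sq] at this
  rw [norm_pos_iff]
  intro h0
  rw [h0] at this
  simp at this
  exact hc.ne this

/-- A conformal differential stretches all directions equally. This gives the factor `1 / |φ'|` of
the lift under a change of coordinate. -/
theorem IsConformalChart.norm_fderiv (hf : IsConformalChart f U) (hz : z ∈ U) (v : ℂ) :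
    ‖fderiv ℝ f z v‖ = ‖v‖ * ‖fderiv ℝ f z 1‖ := by
  obtain ⟨c, hc, h⟩ := hf.exists_inner hz
  have h1 := h 1 1
  have h2 := h v v
  rw [real_inner_self_eq_norm_sq, real_inner_self_eq_norm_sq] at h1 h2
  rw [← sq_eq_sq₀ (norm_nonneg _) (by positivity), h2, mul_pow, h1]
  simp; ring

/-- The light cone vector `(1, f)`. -/
noncomputable def sphereLift (f : ℂ → E4) (z : ℂ) : Fin 5 → ℂ :=
  fun i => (((Fin.cons 1 (fun j : Fin 4 => f z j) : Fin 5 → ℝ) i : ℝ) : ℂ)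

/-- The scale factor `1 / |f_u|` of the canonical lift. -/
noncomputable def liftScale (f : ℂ → E4) (z : ℂ) : ℂ := ((‖fderiv ℝ f z 1‖⁻¹ : ℝ) : ℂ)

theorem canonicalLift_eq (f : ℂ → E4) (z : ℂ) :
    canonicalLift f z = liftScale f z • sphereLift f z := by
  funext i
  simp [canonicalLift, liftScale, sphereLift]

theorem smooth_ofReal {r : ℂ → ℝ} (hr : ContDiffOn ℝ ∞ r U) :
    ContDiffOn ℝ ∞ (fun w => (r w : ℂ)) U :=
  Complex.ofRealCLM.contDiff.comp_contDiffOn hr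

theorem IsConformalChart.smooth_coord (hf : IsConformalChart f U) (j : Fin 4) :
    ContDiffOn ℝ ∞ (fun w => f w j) U :=
  (EuclideanSpace.proj (𝕜 := ℝ) j).contDiff.comp_contDiffOn hf.smooth

theorem IsConformalChart.smooth_sphereLift (hf : IsConformalChart f U) :
    VSmooth (sphereLift f) U := by
  intro i
  refine Fin.cases ?_ (fun j => ?_) i
  · simpa [sphereLift] using contDiffOn_const
  · simpa [sphereLift] using smooth_ofReal (hf.smooth_coord j)

theorem IsConformalChart.smooth_liftScale (hf : IsConformalChart f U) :
    ContDiffOn ℝ ∞ (liftScale f) U := by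
  refine smooth_ofReal (ContDiffOn.inv ?_ fun w hw => (hf.norm_fderiv_pos hw).ne')
  exact (smooth_fderiv_apply hf.isOpen hf.smooth 1).norm ℝ
    fun w hw => norm_pos_iff.1 (hf.norm_fderiv_pos hw)

theorem IsConformalChart.smooth_lift (hf : IsConformalChart f U) :
    VSmooth (canonicalLift f) U := by
  intro i
  simp only [canonicalLift_eq, Pi.smul_apply, smul_eq_mul]
  exact hf.smooth_liftScale.mul (hf.smooth_sphereLift i)

theorem IsConformalChart.smooth_liftZ (hf : IsConformalChart f U) : VSmooth (liftZ f) U :=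
  hf.smooth_lift.vdz hf.isOpen

theorem IsConformalChart.smooth_liftZbar (hf : IsConformalChart f U) : VSmooth (liftZbar f) U :=
  hf.smooth_lift.vdzbar hf.isOpen

theorem IsConformalChart.smooth_liftZZ (hf : IsConformalChart f U) : VSmooth (liftZZ f) U :=
  hf.smooth_liftZ.vdz hf.isOpen

theorem IsConformalChart.smooth_liftZZbar (hf : IsConformalChart f U) :
    VSmooth (liftZZbar f) U :=
  hf.smooth_liftZ.vdzbar hf.isOpen

theorem IsConformalChart.mink_sphereLift (hf : IsConformalChart f U) (z : ℂ) :
    mink (sphereLift f z) (sphereLift f z) = 0 := by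
  have h : ∑ i, f z i * f z i = 1 := by
    have h := EuclideanSpace.norm_sq_eq (f z)
    rw [hf.norm_eq] at h
    simpa [Real.norm_eq_abs, sq_abs, ← pow_two] using h.symm
  have h2 : ∑ i, (f z i : ℂ) * f z i = 1 := by exact_mod_cast h
  simp only [mink, sphereLift, Fin.cons_zero, Fin.cons_succ, h2]
  simp

theorem IsConformalChart.fderiv_sphereLift (hf : IsConformalChart f U) (hz : z ∈ U) (v : ℂ)
    (j : Fin 4) : fderiv ℝ (fun w => sphereLift f w j.succ) z v = (fderiv ℝ f z v j : ℝ) := by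
  have hd := (differentiableAt_of_smooth hf.isOpen hf.smooth hz).hasFDerivAt
  have h1 := (Complex.ofRealCLM.hasFDerivAt.comp z
    ((EuclideanSpace.proj (𝕜 := ℝ) j).hasFDerivAt.comp z hd)).fderiv
  have h2 : (fun w => sphereLift f w j.succ)
    = (Complex.ofRealCLM ∘ (EuclideanSpace.proj (𝕜 := ℝ) j) ∘ f) := by
    funext w; simp [sphereLift]
  rw [h2, h1]
  simp

theorem IsConformalChart.vdz_sphereLift (hf : IsConformalChart f U) (hz : z ∈ U) :
    vdz (sphereLift f) z = Fin.cons 0 fun j : Fin 4 =>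
      ((fderiv ℝ f z 1 j : ℝ) - Complex.I * (fderiv ℝ f z Complex.I j : ℝ)) / 2 := by
  funext i
  refine Fin.cases ?_ (fun j => ?_) i
  · simp [vdz, sphereLift]
  · simp [vdz, dz, hf.fderiv_sphereLift hz]

theorem IsConformalChart.vdzbar_sphereLift (hf : IsConformalChart f U) (hz : z ∈ U) :
    vdzbar (sphereLift f) z = Fin.cons 0 fun j : Fin 4 =>
      ((fderiv ℝ f z 1 j : ℝ) + Complex.I * (fderiv ℝ f z Complex.I j : ℝ)) / 2 := by
  funext i
  refine Fin.cases ?_ (fun j => ?_) i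
  · simp [vdzbar, sphereLift]
  · simp [vdzbar, dzbar, hf.fderiv_sphereLift hz]

/-- Conformality in components, `|f_u| = |f_v|` and `f_u ⊥ f_v`, cast to `ℂ` for use with `mink`. -/
theorem IsConformalChart.sums (hf : IsConformalChart f U) (hz : z ∈ U) :
    (∑ j, ((fderiv ℝ f z 1 j : ℝ) : ℂ) ^ 2 = (‖fderiv ℝ f z 1‖ : ℂ) ^ 2) ∧
    (∑ j, ((fderiv ℝ f z Complex.I j : ℝ) : ℂ) ^ 2 = (‖fderiv ℝ f z 1‖ : ℂ) ^ 2) ∧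
    (∑ j, ((fderiv ℝ f z 1 j : ℝ) : ℂ) * (fderiv ℝ f z Complex.I j : ℝ) = 0) := by
  obtain ⟨c, hc, h⟩ := hf.exists_inner hz
  have key : ∀ u v : ℂ, ∑ j, fderiv ℝ f z u j * fderiv ℝ f z v j = c * inner ℝ u v := by
    intro u v
    rw [← h u v, PiLp.inner_apply]
    exact Finset.sum_congr rfl fun j _ => by simp [mul_comm]
  have hn : ‖fderiv ℝ f z 1‖ ^ 2 = c := by
    rw [← real_inner_self_eq_norm_sq, h 1 1]; simp
  have h1 := key 1 1
  have h2 := key Complex.I Complex.I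
  have h3 := key 1 Complex.I
  rw [real_inner_self_eq_norm_sq] at h1 h2
  simp only [norm_one, Complex.norm_I, one_pow, mul_one] at h1 h2
  rw [show inner ℝ (1 : ℂ) Complex.I = 0 by simp [Complex.inner], mul_zero] at h3
  rw [← hn] at h1 h2
  refine ⟨?_, ?_, ?_⟩
  · simp only [pow_two] at h1 ⊢; exact_mod_cast h1
  · simp only [pow_two] at h2 ⊢; exact_mod_cast h2
  · exact_mod_cast h3

theorem IsConformalChart.mink_lift_lift (hf : IsConformalChart f U) (z : ℂ) :
    mink (canonicalLift f z) (canonicalLift f z) = 0 := by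
  rw [canonicalLift_eq, mink_smul_left, mink_smul_right, hf.mink_sphereLift]; simp

theorem IsConformalChart.mink_vdz_sphereLift (hf : IsConformalChart f U) (hz : z ∈ U) :
    mink (vdz (sphereLift f) z) (vdz (sphereLift f) z) = 0 := by
  obtain ⟨h1, h2, h3⟩ := hf.sums hz
  rw [hf.vdz_sphereLift hz]
  simp only [mink, Fin.cons_zero, Fin.cons_succ, Fin.sum_univ_four] at *
  linear_combination h1 / 4 - h2 / 4 - Complex.I / 2 * h3
    + (((fderiv ℝ f z Complex.I 0 : ℝ) : ℂ) ^ 2 + ((fderiv ℝ f z Complex.I 1 : ℝ) : ℂ) ^ 2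
      + ((fderiv ℝ f z Complex.I 2 : ℝ) : ℂ) ^ 2 + ((fderiv ℝ f z Complex.I 3 : ℝ) : ℂ) ^ 2) / 4
      * Complex.I_sq

theorem IsConformalChart.mink_vdz_vdzbar_sphereLift (hf : IsConformalChart f U) (hz : z ∈ U) :
    mink (vdz (sphereLift f) z) (vdzbar (sphereLift f) z) = (‖fderiv ℝ f z 1‖ : ℂ) ^ 2 / 2 := by
  obtain ⟨h1, h2, h3⟩ := hf.sums hz
  rw [hf.vdz_sphereLift hz, hf.vdzbar_sphereLift hz]
  simp only [mink, Fin.cons_zero, Fin.cons_succ, Fin.sum_univ_four] at *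
  linear_combination h1 / 4 + h2 / 4
    - (((fderiv ℝ f z Complex.I 0 : ℝ) : ℂ) ^ 2 + ((fderiv ℝ f z Complex.I 1 : ℝ) : ℂ) ^ 2
      + ((fderiv ℝ f z Complex.I 2 : ℝ) : ℂ) ^ 2 + ((fderiv ℝ f z Complex.I 3 : ℝ) : ℂ) ^ 2) / 4
      * Complex.I_sq

theorem IsConformalChart.liftZ_eq (hf : IsConformalChart f U) (hz : z ∈ U) :
    liftZ f z = dz (liftScale f) z • sphereLift f z + liftScale f z • vdz (sphereLift f) z := by
  funext i
  simp only [liftZ, vdz, canonicalLift_eq, Pi.smul_apply, Pi.add_apply, smul_eq_mul]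
  exact dz_mul (differentiableAt_of_smooth hf.isOpen hf.smooth_liftScale hz)
    (differentiableAt_of_smooth hf.isOpen (hf.smooth_sphereLift i) hz)

theorem IsConformalChart.liftZbar_eq (hf : IsConformalChart f U) (hz : z ∈ U) :
    liftZbar f z
      = dzbar (liftScale f) z • sphereLift f z + liftScale f z • vdzbar (sphereLift f) z := by
  funext i
  simp only [liftZbar, vdzbar, canonicalLift_eq, Pi.smul_apply, Pi.add_apply, smul_eq_mul]
  exact dzbar_mul (differentiableAt_of_smooth hf.isOpen hf.smooth_liftScale hz)
    (differentiableAt_of_smooth hf.isOpen (hf.smooth_sphereLift i) hz)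

/-- The vector `(1, f)` is null, hence orthogonal to its own derivatives. Derivatives of the scale
factor therefore drop out, and only the conformality of `f` remains. -/
theorem IsConformalChart.mink_Z_Z (hf : IsConformalChart f U) (hz : z ∈ U) :
    mink (liftZ f z) (liftZ f z) = 0 := by
  have h := dz_mink_of_const hf.isOpen hf.smooth_sphereLift hf.smooth_sphereLift
    (fun w _ => hf.mink_sphereLift w) hz
  rw [mink_comm (sphereLift f z), ← two_mul] at h
  have h' : mink (vdz (sphereLift f) z) (sphereLift f z) = 0 := by simpa using h
  rw [hf.liftZ_eq hz]
  simp only [mink_add_left, mink_add_right, mink_smul_left, mink_smul_right,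
    hf.mink_sphereLift, h', mink_comm (sphereLift f z), hf.mink_vdz_sphereLift hz]
  simp

theorem IsConformalChart.mink_Z_Zbar (hf : IsConformalChart f U) (hz : z ∈ U) :
    mink (liftZ f z) (liftZbar f z) = 1 / 2 := by
  have h := dz_mink_of_const hf.isOpen hf.smooth_sphereLift hf.smooth_sphereLift
    (fun w _ => hf.mink_sphereLift w) hz
  have h1 := dzbar_mink_of_const hf.isOpen hf.smooth_sphereLift hf.smooth_sphereLift
    (fun w _ => hf.mink_sphereLift w) hz
  rw [mink_comm (sphereLift f z), ← two_mul] at h h1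
  have h' : mink (vdz (sphereLift f) z) (sphereLift f z) = 0 := by simpa using h
  have h1' : mink (vdzbar (sphereLift f) z) (sphereLift f z) = 0 := by simpa using h1
  rw [hf.liftZ_eq hz, hf.liftZbar_eq hz]
  simp only [mink_add_left, mink_add_right, mink_smul_left, mink_smul_right,
    hf.mink_sphereLift, h', h1', mink_comm (sphereLift f z), hf.mink_vdz_vdzbar_sphereLift hz]
  have h0 : (‖fderiv ℝ f z 1‖ : ℂ) ≠ 0 := by exact_mod_cast (hf.norm_fderiv_pos hz).ne'
  simp only [liftScale]
  push_cast
  field_simp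
  ring

/-! Complex conjugation. -/

theorem conj_lift (f : ℂ → E4) (z : ℂ) :
    (fun i => conj (canonicalLift f z i)) = canonicalLift f z := by
  funext i; exact Complex.conj_ofReal _

theorem IsConformalChart.conj_liftZ (hf : IsConformalChart f U) (hz : z ∈ U) :
    (fun i => conj (liftZ f z i)) = liftZbar f z := by
  funext i
  have h := dzbar_conj (differentiableAt_of_smooth hf.isOpen (hf.smooth_lift i) hz)
  have e : (fun w => conj (canonicalLift f w i)) = fun w => canonicalLift f w i :=
    funext fun w => congrFun (conj_lift f w) i
  rw [e] at h
  exact h.symm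

theorem IsConformalChart.conj_liftZbar (hf : IsConformalChart f U) (hz : z ∈ U) :
    (fun i => conj (liftZbar f z i)) = liftZ f z := by
  rw [← hf.conj_liftZ hz]; simp

theorem IsConformalChart.vdz_liftZbar (hf : IsConformalChart f U) (hz : z ∈ U) :
    vdz (liftZbar f) z = liftZZbar f z :=
  vdz_vdzbar_comm hf.isOpen hf.smooth_lift hz

theorem IsConformalChart.conj_liftZZbar (hf : IsConformalChart f U) (hz : z ∈ U) :
    (fun i => conj (liftZZbar f z i)) = liftZZbar f z := by
  conv_rhs => rw [← hf.vdz_liftZbar hz]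
  funext i
  have h := dz_conj (differentiableAt_of_smooth hf.isOpen (hf.smooth_liftZ i) hz)
  have e : ∀ w ∈ U, conj (liftZ f w i) = liftZbar f w i :=
    fun w hw => congrFun (hf.conj_liftZ hw) i
  rw [dz_congr_on hf.isOpen e hz] at h
  exact h.symm

theorem IsConformalChart.conj_liftZZ (hf : IsConformalChart f U) (hz : z ∈ U) :
    (fun i => conj (liftZZ f z i)) = vdzbar (liftZbar f) z := by
  funext i
  have h := dzbar_conj (differentiableAt_of_smooth hf.isOpen (hf.smooth_liftZ i) hz)
  have e : ∀ w ∈ U, conj (liftZ f w i) = liftZbar f w i :=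
    fun w hw => congrFun (hf.conj_liftZ hw) i
  rw [dzbar_congr_on hf.isOpen e hz] at h
  exact h.symm

/-! The Gram matrix. -/

theorem IsConformalChart.mink_Y_Z (hf : IsConformalChart f U) (hz : z ∈ U) :
    mink (canonicalLift f z) (liftZ f z) = 0 := by
  have h := dz_mink_of_const hf.isOpen hf.smooth_lift hf.smooth_lift
    (fun w _ => hf.mink_lift_lift w) hz
  rw [mink_comm, ← two_mul] at h
  simpa [liftZ] using h

theorem IsConformalChart.mink_Y_Zbar (hf : IsConformalChart f U) (hz : z ∈ U) :
    mink (canonicalLift f z) (liftZbar f z) = 0 := by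
  rw [← conj_lift, ← hf.conj_liftZ hz, mink_conj, hf.mink_Y_Z hz, map_zero]

theorem IsConformalChart.mink_Zbar_Zbar (hf : IsConformalChart f U) (hz : z ∈ U) :
    mink (liftZbar f z) (liftZbar f z) = 0 := by
  rw [← hf.conj_liftZ hz, mink_conj, hf.mink_Z_Z hz, map_zero]

theorem IsConformalChart.mink_ZZbar_Y (hf : IsConformalChart f U) (hz : z ∈ U) :
    mink (liftZZbar f z) (canonicalLift f z) = -1 / 2 := by
  have h := dzbar_mink_of_const hf.isOpen hf.smooth_liftZ hf.smooth_lift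
    (fun w hw => (mink_comm _ _).trans (hf.mink_Y_Z hw)) hz
  have h2 := hf.mink_Z_Zbar hz
  simp only [liftZZbar, liftZbar] at *
  linear_combination h - h2

theorem IsConformalChart.mink_ZZ_Y (hf : IsConformalChart f U) (hz : z ∈ U) :
    mink (liftZZ f z) (canonicalLift f z) = 0 := by
  have h := dz_mink_of_const hf.isOpen hf.smooth_liftZ hf.smooth_lift
    (fun w hw => (mink_comm _ _).trans (hf.mink_Y_Z hw)) hz
  have h2 := hf.mink_Z_Z hz
  simp only [liftZZ, liftZ] at *
  linear_combination h - h2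

theorem IsConformalChart.mink_ZZbar_Z (hf : IsConformalChart f U) (hz : z ∈ U) :
    mink (liftZZbar f z) (liftZ f z) = 0 := by
  have h := dzbar_mink_of_const hf.isOpen hf.smooth_liftZ hf.smooth_liftZ
    (fun w hw => hf.mink_Z_Z hw) hz
  rw [mink_comm (liftZ f z), ← two_mul] at h
  simpa [liftZZbar] using h

theorem IsConformalChart.mink_ZZ_Z (hf : IsConformalChart f U) (hz : z ∈ U) :
    mink (liftZZ f z) (liftZ f z) = 0 := by
  have h := dz_mink_of_const hf.isOpen hf.smooth_liftZ hf.smooth_liftZ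
    (fun w hw => hf.mink_Z_Z hw) hz
  rw [mink_comm (liftZ f z), ← two_mul] at h
  simpa [liftZZ] using h

theorem IsConformalChart.mink_ZZbar_Zbar (hf : IsConformalChart f U) (hz : z ∈ U) :
    mink (liftZZbar f z) (liftZbar f z) = 0 := by
  rw [← hf.conj_liftZ hz, ← hf.conj_liftZZbar hz, mink_conj, hf.mink_ZZbar_Z hz, map_zero]

theorem IsConformalChart.mink_ZZ_Zbar (hf : IsConformalChart f U) (hz : z ∈ U) :
    mink (liftZZ f z) (liftZbar f z) = 0 := by
  have h := dz_mink_of_const hf.isOpen hf.smooth_liftZ hf.smooth_liftZbar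
    (fun w hw => hf.mink_Z_Zbar hw) hz
  rw [hf.vdz_liftZbar hz, mink_comm (liftZ f z), hf.mink_ZZbar_Z hz, add_zero] at h
  exact h

theorem IsConformalChart.vdz_liftZZbar (hf : IsConformalChart f U) (hz : z ∈ U) :
    vdz (liftZZbar f) z = vdzbar (liftZZ f) z :=
  vdz_vdzbar_comm hf.isOpen hf.smooth_liftZ hz

/-- `⟨Y_{z z̄}, Y_{z z̄}⟩ = ⟨Y_{zz}, Y_{z̄ z̄}⟩`. -/
theorem IsConformalChart.mink_ZZbar_ZZbar (hf : IsConformalChart f U) (hz : z ∈ U) :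
    mink (liftZZbar f z) (liftZZbar f z) = mink (liftZZ f z) (vdzbar (liftZbar f) z) := by
  -- Both relations contain the same term `⟨Y_{z z z̄}, Y_z̄⟩`, which cancels in their difference.
  have h1 := dzbar_mink_of_const hf.isOpen hf.smooth_liftZZ hf.smooth_liftZbar
    (fun w hw => hf.mink_ZZ_Zbar hw) hz
  have h2 := dz_mink_of_const hf.isOpen hf.smooth_liftZZbar hf.smooth_liftZbar
    (fun w hw => hf.mink_ZZbar_Zbar hw) hz
  rw [hf.vdz_liftZZbar hz, hf.vdz_liftZbar hz] at h2
  linear_combination h2 - h1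

/-! ### Schwarzian and Hopfian through determinants -/

theorem IsConformalChart.schwarzian_eq (hf : IsConformalChart f U) (hz : z ∈ U) :
    schwarzian f z = 4 * mink (liftZZ f z) (liftZZbar f z) := by
  rw [schwarzian, frameN, mink_add_right, mink_smul_right, mink_smul_right, hf.mink_ZZ_Y hz]
  ring

/-- The component of a vector along the conformal Gauss map. -/
noncomputable def normalPart (f : ℂ → E4) (z : ℂ) (v : Fin 5 → ℂ) : ℂ :=
  -4 * Complex.I * frameDet (canonicalLift f z) (liftZ f z) (liftZbar f z) (liftZZbar f z) v

/-- The constant `-4i` is the Jacobian of the passage from `Y_z, Y_z̄, Y_{z z̄}` to `Y_u, Y_v, N`: a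
factor `-2i` from the tangent vectors and `2` from `N`. -/
theorem mink_gaussMap (f : ℂ → E4) (z : ℂ) (v : Fin 5 → ℂ) :
    mink v (gaussMap f z) = normalPart f z v := by
  rw [mink_comm, gaussMap, mink_cross_eq_frameDet, frameN, frameDet_frame, normalPart]

theorem hopfian_eq_normalPart (f : ℂ → E4) (z : ℂ) :
    hopfian f z = normalPart f z (liftZZ f z) := by
  rw [hopfian, mink_gaussMap, normalPart, frameDet_add_smul_last, normalPart]

theorem IsConformalChart.smooth_hopfian (hf : IsConformalChart f U) :
    ContDiffOn ℝ ∞ (hopfian f) U := by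
  rw [funext (hopfian_eq_normalPart f)]
  exact contDiffOn_const.mul (hf.smooth_lift.frameDet hf.smooth_liftZ hf.smooth_liftZbar
    hf.smooth_liftZZbar hf.smooth_liftZZ)

theorem IsConformalChart.smooth_schwarzian (hf : IsConformalChart f U) :
    ContDiffOn ℝ ∞ (schwarzian f) U :=
  (contDiffOn_const.mul (hf.smooth_liftZZ.mink hf.smooth_liftZZbar)).congr
    fun _ hw => hf.schwarzian_eq hw

/-- Conjugation swaps two rows of the determinant, and this sign cancels against that of `conj
(-4i)`: the normal component is real. -/
theorem IsConformalChart.conj_hopfian (hf : IsConformalChart f U) (hz : z ∈ U) :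
    conj (hopfian f z) = normalPart f z (vdzbar (liftZbar f) z) := by
  rw [hopfian_eq_normalPart, normalPart, map_mul, ← frameDet_conj, conj_lift, hf.conj_liftZ hz,
    hf.conj_liftZbar hz, hf.conj_liftZZbar hz, hf.conj_liftZZ hz, frameDet_swap_middle, normalPart]
  simp [Complex.conj_ofNat]

/-- `⟨v, Y_{zz} + (s/2) Y⟩ = ⟨v, X⟩ κ`. -/
theorem IsConformalChart.mink_ZZ_add (hf : IsConformalChart f U) (hz : z ∈ U) (v : Fin 5 → ℂ) :
    mink v (liftZZ f z + (schwarzian f z / 2) • canonicalLift f z)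
      = normalPart f z v * hopfian f z := by
  have hs := hf.schwarzian_eq hz
  rw [mink_eq_det_mul_det (hf.mink_lift_lift z) (hf.mink_Y_Z hz) (hf.mink_Y_Zbar hz)
    (hf.mink_Z_Z hz) (hf.mink_Zbar_Zbar hz) (hf.mink_Z_Zbar hz) (hf.mink_ZZbar_Y hz)
    (hf.mink_ZZbar_Z hz) (hf.mink_ZZbar_Zbar hz), frameDet_add_smul_last,
    hopfian_eq_normalPart, normalPart, normalPart]
  · rw [mink_add_right, mink_smul_right, hf.mink_lift_lift, mink_comm, hf.mink_ZZ_Y hz]; simp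
  · rw [mink_add_right, mink_smul_right, mink_comm, hf.mink_ZZ_Z hz, mink_comm, hf.mink_Y_Z hz]
    simp
  · rw [mink_add_right, mink_smul_right, mink_comm, hf.mink_ZZ_Zbar hz, mink_comm,
      hf.mink_Y_Zbar hz]
    simp
  -- Here the coefficient `s/2` is forced: `⟨Y_{zz}, Y_{z z̄}⟩ = s/4` has to cancel `(s/2) ⟨Y_{z
  -- z̄}, Y⟩ = -s/4`.
  · rw [mink_add_right, mink_smul_right, hf.mink_ZZbar_Y hz, mink_comm]
    linear_combination -hs / 4

theorem IsConformalChart.mink_conj_ZZ_add (hf : IsConformalChart f U) (hz : z ∈ U)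
    (v : Fin 5 → ℂ) :
    mink v (vdzbar (liftZbar f) z + (conj (schwarzian f z) / 2) • canonicalLift f z)
      = normalPart f z v * conj (hopfian f z) := by
  have h := congrArg conj (hf.mink_ZZ_add hz (fun i => conj (v i)))
  rw [← mink_conj, map_mul, normalPart, map_mul, ← frameDet_conj, conj_lift, hf.conj_liftZ hz,
    hf.conj_liftZbar hz, hf.conj_liftZZbar hz, frameDet_swap_middle] at h
  have e : (fun i => conj ((liftZZ f z + (schwarzian f z / 2) • canonicalLift f z) i))
      = vdzbar (liftZbar f) z + (conj (schwarzian f z) / 2) • canonicalLift f z := by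
    rw [← hf.conj_liftZZ hz]
    conv_rhs => rw [← conj_lift f z]
    funext i; simp [Complex.conj_ofNat]
  rw [e] at h
  simp only [Complex.conj_conj] at h
  rw [h, normalPart]
  simp [Complex.conj_ofNat]

/-- `|κ|² = ⟨Y_{z z̄}, Y_{z z̄}⟩`. -/
theorem IsConformalChart.hopfian_mul_conj (hf : IsConformalChart f U) (hz : z ∈ U) :
    hopfian f z * conj (hopfian f z) = mink (liftZZbar f z) (liftZZbar f z) := by
  -- The normal component of `Y_{z̄ z̄}` is `κ̄`, and `Y_{z̄ z̄}` is orthogonal to `Y`.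
  have h := hf.mink_ZZ_add hz (vdzbar (liftZbar f) z)
  rw [← hf.conj_hopfian hz, mink_add_right, mink_smul_right, ← hf.conj_liftZZ hz] at h
  have h2 : mink (fun i => conj (liftZZ f z i)) (canonicalLift f z) = 0 := by
    rw [← conj_lift, mink_conj, hf.mink_ZZ_Y hz, map_zero]
  rw [h2, mink_comm, hf.conj_liftZZ hz] at h
  rw [hf.mink_ZZbar_ZZbar hz]
  linear_combination -h

theorem IsConformalChart.mink_conjZZ_Y (hf : IsConformalChart f U) (hz : z ∈ U) :
    mink (vdzbar (liftZbar f) z) (canonicalLift f z) = 0 := by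
  rw [← hf.conj_liftZZ hz, ← conj_lift, mink_conj, hf.mink_ZZ_Y hz, map_zero]

theorem IsConformalChart.mink_conjZZ_Z (hf : IsConformalChart f U) (hz : z ∈ U) :
    mink (vdzbar (liftZbar f) z) (liftZ f z) = 0 := by
  rw [← hf.conj_liftZZ hz, ← hf.conj_liftZbar hz, mink_conj, hf.mink_ZZ_Zbar hz, map_zero]

/-- `κ̄² = ⟨Y_{z̄ z̄}, Y_{z̄ z̄}⟩`. -/
theorem IsConformalChart.conj_hopfian_sq (hf : IsConformalChart f U) (hz : z ∈ U) :
    mink (vdzbar (liftZbar f) z) (vdzbar (liftZbar f) z)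
      = conj (hopfian f z) * conj (hopfian f z) := by
  have h := hf.mink_conj_ZZ_add hz (vdzbar (liftZbar f) z)
  rw [← hf.conj_hopfian hz, mink_add_right, mink_smul_right, hf.mink_conjZZ_Y hz] at h
  linear_combination h

/-- The Gauss equation. -/
theorem IsConformalChart.gauss (hf : IsConformalChart f U) (hz : z ∈ U)
    (h0 : hopfian f z ≠ 0) :
    dzbar (schwarzian f) z
      = 2 * dz (fun w => hopfian f w * conj (hopfian f w)) z
        + 4 * (hopfian f z * dz (fun w => conj (hopfian f w)) z) := by
  have hC : VSmooth (vdzbar (liftZbar f)) U := hf.smooth_liftZbar.vdzbar hf.isOpen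
  have hκ := differentiableAt_of_smooth hf.isOpen (smooth_conj hf.smooth_hopfian) hz
  have e1 : dzbar (schwarzian f) z = 4 * (mink (vdzbar (liftZZ f) z) (liftZZbar f z)
      + mink (liftZZ f z) (vdzbar (liftZZbar f) z)) := by
    rw [dzbar_congr_on hf.isOpen (fun w hw => hf.schwarzian_eq hw) hz,
      dzbar_const_mul _ (differentiableAt_of_smooth hf.isOpen
        (hf.smooth_liftZZ.mink hf.smooth_liftZZbar) hz),
      dzbar_mink hf.isOpen hf.smooth_liftZZ hf.smooth_liftZZbar hz]
  have e2 : vdzbar (liftZZbar f) z = vdz (vdzbar (liftZbar f)) z := by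
    rw [vdz_vdzbar_comm hf.isOpen hf.smooth_liftZbar hz]
    exact vdzbar_congr_on hf.isOpen (fun w hw => (hf.vdz_liftZbar hw).symm) hz
  have e3 : dz (fun w => hopfian f w * conj (hopfian f w)) z
      = 2 * mink (vdzbar (liftZZ f) z) (liftZZbar f z) := by
    rw [dz_congr_on hf.isOpen (fun w hw => hf.hopfian_mul_conj hw) hz,
      dz_mink hf.isOpen hf.smooth_liftZZbar hf.smooth_liftZZbar hz, hf.vdz_liftZZbar hz,
      mink_comm (liftZZbar f z)]
    ring
  have e4 : mink (vdz (vdzbar (liftZbar f)) z) (vdzbar (liftZbar f) z)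
      = conj (hopfian f z) * dz (fun w => conj (hopfian f w)) z := by
    have h := dz_mink hf.isOpen hC hC hz
    rw [dz_congr_on hf.isOpen (fun w hw => hf.conj_hopfian_sq hw) hz, dz_mul hκ hκ,
      mink_comm (vdzbar (liftZbar f) z)] at h
    linear_combination -h / 2
  have e5 : mink (vdz (vdzbar (liftZbar f)) z) (canonicalLift f z) = 0 := by
    have h := dz_mink_of_const hf.isOpen hC hf.smooth_lift (fun w hw => hf.mink_conjZZ_Y hw) hz
    have h2 := hf.mink_conjZZ_Z hz
    rw [liftZ] at h2
    rwa [h2, add_zero] at h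
  -- Let `n` be the normal component of `Y_{z z̄ z̄}`. As this vector is orthogonal to `Y`, its
  -- products with `Y_{zz}` and `Y_{z̄ z̄}` are `nκ` and `nκ̄`. The second is `κ̄ κ̄_z` by `e4`;
  -- cancelling `κ̄` gives `n = κ̄_z`, hence the first.
  have h1 := hf.mink_ZZ_add hz (vdz (vdzbar (liftZbar f)) z)
  have h2 := hf.mink_conj_ZZ_add hz (vdz (vdzbar (liftZbar f)) z)
  rw [mink_add_right, mink_smul_right, e5, mul_zero, add_zero] at h1 h2
  rw [e4] at h2
  have h0' : conj (hopfian f z) ≠ 0 := by simpa using h0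
  have e6 : mink (liftZZ f z) (vdz (vdzbar (liftZbar f)) z)
      = hopfian f z * dz (fun w => conj (hopfian f w)) z := by
    rw [mink_comm, h1]
    apply mul_left_cancel₀ h0'
    linear_combination -hopfian f z * h2
  rw [e1, e2, e3, e6]
  ring

end Coordinate

section Invariants

open scoped ComplexConjugate

variable {f g : ℂ → E4} {k l : ℂ → ℂ} {U : Set ℂ} {z : ℂ}

/-! ### Logarithmic derivatives -/

/-- The logarithmic derivative `k_z̄ / k`. -/
noncomputable def logDzbar (k : ℂ → ℂ) (z : ℂ) : ℂ := dzbar k z / k z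

/-- The logarithmic derivative `k_z / k`. -/
noncomputable def logDz (k : ℂ → ℂ) (z : ℂ) : ℂ := dz k z / k z

theorem dzbar_eq_logDzbar_mul (h0 : k z ≠ 0) : dzbar k z = logDzbar k z * k z :=
  (div_mul_cancel₀ _ h0).symm

theorem dz_eq_logDz_mul (h0 : k z ≠ 0) : dz k z = logDz k z * k z :=
  (div_mul_cancel₀ _ h0).symm

theorem smooth_div (hk : ContDiffOn ℝ ∞ k U) (hl : ContDiffOn ℝ ∞ l U) (h0 : ∀ w ∈ U, l w ≠ 0) :
    ContDiffOn ℝ ∞ (fun w => k w / l w) U := by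
  simp only [div_eq_mul_inv]
  exact hk.mul (hl.inv h0)

theorem smooth_logDzbar (hU : IsOpen U) (hk : ContDiffOn ℝ ∞ k U) (h0 : ∀ w ∈ U, k w ≠ 0) :
    ContDiffOn ℝ ∞ (logDzbar k) U :=
  smooth_div (smooth_dzbar hU hk) hk h0

theorem smooth_logDz (hU : IsOpen U) (hk : ContDiffOn ℝ ∞ k U) (h0 : ∀ w ∈ U, k w ≠ 0) :
    ContDiffOn ℝ ∞ (logDz k) U :=
  smooth_div (smooth_dz hU hk) hk h0

/-- Both sides are the mixed second derivative of `log k`; the quotient rule avoids choosing a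
branch. -/
theorem dzbar_logDz (hU : IsOpen U) (hk : ContDiffOn ℝ ∞ k U) (h0 : ∀ w ∈ U, k w ≠ 0)
    (hz : z ∈ U) : dzbar (logDz k) z = dz (logDzbar k) z := by
  have d0 := differentiableAt_of_smooth hU hk hz
  have d1 := differentiableAt_of_smooth hU (smooth_dz hU hk) hz
  have d2 := differentiableAt_of_smooth hU (smooth_dzbar hU hk) hz
  have e1 := dzbar_div d1 d0 (h0 z hz)
  have e2 := dz_div d2 d0 (h0 z hz)
  rw [dz_dzbar_comm hU hk hz] at e2
  refine e1.trans (Eq.trans ?_ e2.symm)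
  ring

theorem dz_mul_conj (hU : IsOpen U) (hk : ContDiffOn ℝ ∞ k U) (hz : z ∈ U) (h0 : k z ≠ 0) :
    dz (fun w => k w * conj (k w)) z
      = (logDz k z + conj (logDzbar k z)) * (k z * conj (k z)) := by
  have d0 := differentiableAt_of_smooth hU hk hz
  have d1 := differentiableAt_of_smooth hU (smooth_conj hk) hz
  rw [dz_mul d0 d1, dz_conj d0, dz_eq_logDz_mul h0, dzbar_eq_logDzbar_mul h0, map_mul]
  ring

theorem dzbar_mul_conj (hU : IsOpen U) (hk : ContDiffOn ℝ ∞ k U) (hz : z ∈ U) (h0 : k z ≠ 0) :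
    dzbar (fun w => k w * conj (k w)) z
      = (logDzbar k z + conj (logDz k z)) * (k z * conj (k z)) := by
  have d0 := differentiableAt_of_smooth hU hk hz
  have d1 := differentiableAt_of_smooth hU (smooth_conj hk) hz
  rw [dzbar_mul d0 d1, dzbar_conj d0, dz_eq_logDz_mul h0, dzbar_eq_logDzbar_mul h0, map_mul]
  ring

theorem mul_conj_ne_zero {c : ℂ} (h : c ≠ 0) : c * conj c ≠ 0 :=
  mul_ne_zero h (by simpa using h)

/-! ### The invariants `ρ`, `𝒫`, `𝒦` -/

theorem conj_mu (f : ℂ → E4) (z : ℂ) : conj (mu f z) = -2 * logDzbar (hopfian f) z := by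
  rw [mu, Complex.conj_conj, logDzbar, mul_div_assoc]

theorem IsConformalChart.rho_eq (hf : IsConformalChart f U) (h0 : ∀ w ∈ U, hopfian f w ≠ 0)
    (hz : z ∈ U) : rho f z
      = -2 * dz (logDzbar (hopfian f)) z - 2 * (hopfian f z * conj (hopfian f z)) := by
  rw [rho, funext (conj_mu f), dz_const_mul _ (differentiableAt_of_smooth hf.isOpen
    (smooth_logDzbar hf.isOpen hf.smooth_hopfian h0) hz)]

/-- The Willmore equation in a coordinate domain. -/
def WillmoreOn (f : ℂ → E4) (U : Set ℂ) : Prop :=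
  ∀ z ∈ U, dzbar (dzbar (hopfian f)) z + conj (schwarzian f z) / 2 * hopfian f z = 0

/-- The Willmore equation, linear of second order in `κ`, becomes a Riccati equation for `q =
κ_z̄/κ`. -/
theorem IsConformalChart.dzbar_logDzbar (hf : IsConformalChart f U)
    (h0 : ∀ w ∈ U, hopfian f w ≠ 0) (hW : WillmoreOn f U) (hz : z ∈ U) :
    dzbar (logDzbar (hopfian f)) z
      = -(conj (schwarzian f z)) / 2 - logDzbar (hopfian f) z * logDzbar (hopfian f) z := by
  have d0 := differentiableAt_of_smooth hf.isOpen hf.smooth_hopfian hz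
  have d2 := differentiableAt_of_smooth hf.isOpen (smooth_dzbar hf.isOpen hf.smooth_hopfian) hz
  have hk := h0 z hz
  have hw : dzbar (dzbar (hopfian f)) z = -(conj (schwarzian f z) / 2 * hopfian f z) := by
    linear_combination hW z hz
  refine (dzbar_div d2 d0 hk).trans ?_
  rw [hw, dzbar_eq_logDzbar_mul hk]
  field_simp

theorem IsConformalChart.smooth_rho (hf : IsConformalChart f U)
    (h0 : ∀ w ∈ U, hopfian f w ≠ 0) : ContDiffOn ℝ ∞ (rho f) U :=
  ((contDiffOn_const.mul (smooth_dz hf.isOpen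
    (smooth_logDzbar hf.isOpen hf.smooth_hopfian h0))).sub (contDiffOn_const.mul
    (hf.smooth_hopfian.mul (smooth_conj hf.smooth_hopfian)))).congr fun _ hw => hf.rho_eq h0 hw

/-- Equivalently, the quartic differential `ρ κ² dz⁴` is holomorphic. -/
theorem IsConformalChart.dzbar_rho (hf : IsConformalChart f U)
    (h0 : ∀ w ∈ U, hopfian f w ≠ 0) (hW : WillmoreOn f U) (hz : z ∈ U) :
    dzbar (rho f) z = -2 * logDzbar (hopfian f) z * rho f z := by
  have hU := hf.isOpen
  have hk := h0 z hz
  have hsq := smooth_logDzbar hU hf.smooth_hopfian h0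
  have hsK := hf.smooth_hopfian.mul (smooth_conj hf.smooth_hopfian)
  have dq := differentiableAt_of_smooth hU hsq hz
  have dqz := differentiableAt_of_smooth hU (smooth_dz hU hsq) hz
  have dk := differentiableAt_of_smooth hU hf.smooth_hopfian hz
  have dK := differentiableAt_of_smooth hU hsK hz
  have ds := differentiableAt_of_smooth hU hf.smooth_schwarzian hz
  have dsc := differentiableAt_of_smooth hU (smooth_conj hf.smooth_schwarzian) hz
  have e1 : dzbar (rho f) z = -2 * dzbar (dz (logDzbar (hopfian f))) z
      - 2 * dzbar (fun w => hopfian f w * conj (hopfian f w)) z := by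
    rw [dzbar_congr_on hU (h := fun w => -2 * dz (logDzbar (hopfian f)) w
        + (-2) * (hopfian f w * conj (hopfian f w)))
        (fun w hw => by simp only [hf.rho_eq h0 hw]; ring) hz,
      dzbar_add (dqz.const_mul _) (dK.const_mul _), dzbar_const_mul _ dqz, dzbar_const_mul _ dK]
    ring
  -- The `z`-derivative of the Riccati equation, after interchanging the derivatives of `q`.
  have e2 : dzbar (dz (logDzbar (hopfian f))) z
      = -(dz (fun w => conj (schwarzian f w)) z) / 2
        - 2 * logDzbar (hopfian f) z * dz (logDzbar (hopfian f)) z := by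
    rw [← dz_dzbar_comm hU hsq hz, dz_congr_on hU (h := fun w => (-1 / 2) * conj (schwarzian f w)
      + (-1) * (logDzbar (hopfian f) w * logDzbar (hopfian f) w))
        (fun w hw => by simp only [hf.dzbar_logDzbar h0 hW hw]; ring) hz,
      dz_add (dsc.const_mul _) ((dq.fun_mul dq).const_mul _), dz_const_mul _ dsc,
      dz_const_mul _ (dq.fun_mul dq), dz_mul dq dq]
    ring
  -- The conjugate of the Gauss equation, written with logarithmic derivatives; it eliminates the
  -- Schwarzian from `e2`.
  have e3 : dz (fun w => conj (schwarzian f w)) z = (6 * logDzbar (hopfian f) z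
      + 2 * conj (logDz (hopfian f) z)) * (hopfian f z * conj (hopfian f z)) := by
    rw [dz_conj ds, hf.gauss hz hk, dz_mul_conj hU hf.smooth_hopfian hz hk, dz_conj dk,
      dzbar_eq_logDzbar_mul hk]
    simp only [map_add, map_mul, Complex.conj_conj, Complex.conj_ofNat]
    ring
  rw [e1, e2, e3, dzbar_mul_conj hU hf.smooth_hopfian hz hk, hf.rho_eq h0 hz]
  ring

theorem rho_eq_coordP_mul (h0 : hopfian f z ≠ 0) :
    rho f z = coordP f z * (hopfian f z * conj (hopfian f z)) :=
  (div_mul_cancel₀ _ (mul_conj_ne_zero h0)).symm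

theorem fderiv_ofReal {r : ℂ → ℝ} (hr : DifferentiableAt ℝ r z) (v : ℂ) :
    fderiv ℝ (fun w => (r w : ℂ)) z v = (fderiv ℝ r z v : ℝ) := by
  have h := (Complex.ofRealCLM.hasFDerivAt.comp z hr.hasFDerivAt).fderiv
  rw [show (fun w => (r w : ℂ)) = Complex.ofRealCLM ∘ r from rfl, h]
  simp

theorem dz_ofReal_log {r : ℂ → ℝ} (hr : DifferentiableAt ℝ r z) (h0 : r z ≠ 0) :
    dz (fun w => (Real.log (r w) : ℂ)) z = dz (fun w => (r w : ℂ)) z / r z := by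
  simp only [dz, fderiv_ofReal hr, fderiv_ofReal (hr.log h0), fderiv.log hr h0]
  simp
  field_simp

/-- The curvature of the Möbius metric is determined by `𝒫`. -/
theorem IsConformalChart.coordK_eq (hf : IsConformalChart f U)
    (h0 : ∀ w ∈ U, hopfian f w ≠ 0) (hz : z ∈ U) : coordK f z = 1 + (coordP f z).re / 2 := by
  have hU := hf.isOpen
  have hs := hf.smooth_hopfian
  have hsr : ContDiffOn ℝ ∞ (fun w => 4 * ‖hopfian f w‖ ^ 2) U :=
    contDiffOn_const.mul (hs.norm_sq ℝ)
  have hpos : ∀ w ∈ U, 4 * ‖hopfian f w‖ ^ 2 ≠ 0 := fun w hw => by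
    have := norm_pos_iff.2 (h0 w hw); positivity
  have hnorm : ∀ w, ((4 * ‖hopfian f w‖ ^ 2 : ℝ) : ℂ) = 4 * (hopfian f w * conj (hopfian f w)) :=
    fun w => by rw [Complex.mul_conj, Complex.normSq_eq_norm_sq]; push_cast; rfl
  have e1 : ∀ w ∈ U, dz (fun w => (logFactor f w : ℂ)) w
      = (1 / 2) * (logDz (hopfian f) w + conj (logDzbar (hopfian f) w)) := by
    intro w hw
    have hd := differentiableAt_of_smooth hU hsr hw
    have hd2 : DifferentiableAt ℝ
        (fun w => (Real.log (4 * ‖hopfian f w‖ ^ 2) : ℂ)) w :=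
      Complex.ofRealCLM.differentiableAt.comp w (hd.log (hpos w hw))
    have : (fun w => (logFactor f w : ℂ))
        = fun w => (1 / 2 : ℂ) * (Real.log (4 * ‖hopfian f w‖ ^ 2) : ℂ) := by
      funext w; simp only [logFactor]; push_cast; ring
    rw [this, dz_const_mul _ hd2, dz_ofReal_log hd (hpos w hw)]
    simp only [hnorm]
    rw [dz_const_mul _ (differentiableAt_of_smooth hU (hs.mul (smooth_conj hs)) hw),
      dz_mul_conj hU hs hw (h0 w hw)]
    have := mul_conj_ne_zero (h0 w hw)
    generalize hopfian f w * conj (hopfian f w) = m at *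
    field_simp
  have dq := differentiableAt_of_smooth hU (smooth_logDzbar hU hs h0) hz
  have dqc := differentiableAt_of_smooth hU (smooth_conj (smooth_logDzbar hU hs h0)) hz
  have dr := differentiableAt_of_smooth hU (smooth_logDz hU hs h0) hz
  -- The `z̄`-derivatives of `r` and `q̄` are `q_z` and its conjugate, so `ω_{z z̄} = Re q_z`.
  have e2 : dzbar (dz fun w => (logFactor f w : ℂ)) z = (dz (logDzbar (hopfian f)) z).re := by
    rw [dzbar_congr_on hU e1 hz, dzbar_const_mul _ (dr.fun_add dqc), dzbar_add dr dqc,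
      dzbar_logDz hU hs h0 hz, dzbar_conj dq, Complex.add_conj]
    push_cast
    ring
  have hp := norm_pos_iff.2 (h0 z hz)
  have e3 : Real.exp (-2 * logFactor f z) = (4 * ‖hopfian f z‖ ^ 2)⁻¹ := by
    rw [logFactor, show -2 * (Real.log (4 * ‖hopfian f z‖ ^ 2) / 2)
      = -Real.log (4 * ‖hopfian f z‖ ^ 2) by ring, Real.exp_neg, Real.exp_log (by positivity)]
  have e4 : coordP f z
      = -2 * dz (logDzbar (hopfian f)) z / ((‖hopfian f z‖ ^ 2 : ℝ) : ℂ) - 2 := by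
    have h1 := mul_conj_ne_zero (h0 z hz)
    have h2 : ((‖hopfian f z‖ ^ 2 : ℝ) : ℂ) = hopfian f z * conj (hopfian f z) := by
      rw [Complex.mul_conj, Complex.normSq_eq_norm_sq]
    rw [h2, coordP, hf.rho_eq h0 hz]
    generalize hopfian f z * conj (hopfian f z) = m at *
    field_simp
  rw [coordK, e2, e3, e4, Complex.sub_re, Complex.div_ofReal_re]
  simp
  field_simp
  ring

/-! ### Surfaces with the same `𝒫` -/

/-- The local core: `key`, `hqz`, `hKK` and `hq` successively compare `r - 3q̄`-type combinations,
`q_z`, `|κ|²`, and finally `q` and `r` separately. -/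
theorem IsConformalChart.hopfian_ratio (hf : IsConformalChart f U) (hg : IsConformalChart g U)
    (hf0 : ∀ w ∈ U, hopfian f w ≠ 0) (hg0 : ∀ w ∈ U, hopfian g w ≠ 0)
    (hfW : WillmoreOn f U) (hgW : WillmoreOn g U) (hP : ∀ w ∈ U, coordP f w = coordP g w)
    (hP0 : ∀ w ∈ U, coordP f w ≠ 0) (hK0 : ∀ w ∈ U, coordK f w ≠ 0) (hz : z ∈ U) :
    fderiv ℝ (fun w => hopfian g w / hopfian f w) z = 0 ∧ ‖hopfian g z / hopfian f z‖ = 1 := by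
  have hU := hf.isOpen
  have hsf := hf.smooth_hopfian
  have hsg := hg.smooth_hopfian
  have hKf := hsf.mul (smooth_conj hsf)
  have hKg := hsg.mul (smooth_conj hsg)
  have key : ∀ w ∈ U, (logDz (hopfian g) w - logDz (hopfian f) w)
      = -3 * conj (logDzbar (hopfian g) w - logDzbar (hopfian f) w) := by
    intro w hw
    have dKf := differentiableAt_of_smooth hU hKf hw
    have dKg := differentiableAt_of_smooth hU hKg hw
    have dρf := differentiableAt_of_smooth hU (hf.smooth_rho hf0) hw
    have dρg := differentiableAt_of_smooth hU (hg.smooth_rho hg0) hw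
    -- Equality of `𝒫` cleared of denominators. In the `z̄`-derivative the factor `𝒫 |κ|² |κ̃|²`
    -- comes out, and `𝒫 ≠ 0` allows cancelling it, which leaves `-2q̃ + q + r̄ = -2q + q̃ + conj
    -- r̃`.
    have h : dzbar (fun x => rho g x * (hopfian f x * conj (hopfian f x))) w
        = dzbar (fun x => rho f x * (hopfian g x * conj (hopfian g x))) w := by
      refine dzbar_congr_on hU (fun x hx => ?_) hw
      simp only [rho_eq_coordP_mul (hf0 x hx), rho_eq_coordP_mul (hg0 x hx), hP x hx]
      ring
    rw [dzbar_mul dρg dKf, dzbar_mul dρf dKg, hf.dzbar_rho hf0 hfW hw, hg.dzbar_rho hg0 hgW hw,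
      dzbar_mul_conj hU hsf hw (hf0 w hw), dzbar_mul_conj hU hsg hw (hg0 w hw),
      rho_eq_coordP_mul (hf0 w hw), rho_eq_coordP_mul (hg0 w hw), ← hP w hw] at h
    have hne := mul_ne_zero (hP0 w hw)
      (mul_ne_zero (mul_conj_ne_zero (hf0 w hw)) (mul_conj_ne_zero (hg0 w hw)))
    have h2 : conj (logDz (hopfian g) w - logDz (hopfian f) w)
        = -3 * (logDzbar (hopfian g) w - logDzbar (hopfian f) w) := by
      apply mul_left_cancel₀ hne
      rw [map_sub]
      linear_combination -h
    have h3 := congrArg conj h2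
    rw [Complex.conj_conj, map_mul, map_neg, Complex.conj_ofNat] at h3
    exact h3
  have hqz : ∀ w ∈ U, dz (logDzbar (hopfian g)) w = dz (logDzbar (hopfian f)) w := by
    intro w hw
    have drf := differentiableAt_of_smooth hU (smooth_logDz hU hsf hf0) hw
    have drg := differentiableAt_of_smooth hU (smooth_logDz hU hsg hg0) hw
    have dqf := differentiableAt_of_smooth hU (smooth_logDzbar hU hsf hf0) hw
    have dqg := differentiableAt_of_smooth hU (smooth_logDzbar hU hsg hg0) hw
    have dqfc := differentiableAt_of_smooth hU (smooth_conj (smooth_logDzbar hU hsf hf0)) hw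
    have dqgc := differentiableAt_of_smooth hU (smooth_conj (smooth_logDzbar hU hsg hg0)) hw
    have h := dzbar_congr_on hU (g := fun w => logDz (hopfian g) w + (-1) * logDz (hopfian f) w)
      (h := fun w => (-3) * conj (logDzbar (hopfian g) w) + 3 * conj (logDzbar (hopfian f) w))
      (fun x hx => by have := key x hx; rw [map_sub] at this; linear_combination this) hw
    rw [dzbar_add drg (drf.const_mul _), dzbar_const_mul _ drf,
      dzbar_add (dqgc.const_mul _) (dqfc.const_mul _), dzbar_const_mul _ dqgc,
      dzbar_const_mul _ dqfc, dzbar_conj dqf, dzbar_conj dqg, dzbar_logDz hU hsf hf0 hw,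
      dzbar_logDz hU hsg hg0 hw] at h
    -- Now `h` says `x = -3x̄` for `x = q̃_z - q_z`. Real and imaginary parts give `Re x = -3 Re x`
    -- and `Im x = 3 Im x`, so `x = 0`.
    have hre := congrArg Complex.re h
    have him := congrArg Complex.im h
    simp at hre him
    apply Complex.ext <;> linarith
  have hKK : ∀ w ∈ U, hopfian g w * conj (hopfian g w) = hopfian f w * conj (hopfian f w) := by
    intro w hw
    have h1 := hf.rho_eq hf0 hw
    have h2 := hg.rho_eq hg0 hw
    rw [rho_eq_coordP_mul (hf0 w hw)] at h1
    rw [rho_eq_coordP_mul (hg0 w hw), hqz w hw, ← hP w hw] at h2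
    -- `𝒫 = -2` would give `𝒦 = 1 + Re 𝒫 / 2 = 0`.
    have hne : coordP f w + 2 ≠ 0 := by
      intro h
      have h3 := congrArg Complex.re h
      simp at h3
      apply hK0 w hw
      rw [hf.coordK_eq hf0 hw]
      linarith
    apply mul_left_cancel₀ hne
    linear_combination h2 - h1
  have hq : logDzbar (hopfian g) z = logDzbar (hopfian f) z ∧
      logDz (hopfian g) z = logDz (hopfian f) z := by
    -- Equal `|κ|²` gives `r̃ - r = -conj(q̃ - q)`, whereas `key` has the factor `-3`; both
    -- differences must vanish.
    have h := dz_congr_on hU hKK hz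
    rw [dz_mul_conj hU hsf hz (hf0 z hz), dz_mul_conj hU hsg hz (hg0 z hz), hKK z hz] at h
    have h1 := mul_right_cancel₀ (mul_conj_ne_zero (hf0 z hz)) h
    have h2 := key z hz
    rw [map_sub] at h2
    have h3 : conj (logDzbar (hopfian g) z) = conj (logDzbar (hopfian f) z) := by
      linear_combination (h2 - h1) / 2
    have h4 := (starRingEnd ℂ).injective h3
    refine ⟨h4, ?_⟩
    rw [h3] at h1
    exact add_right_cancel h1
  have df := differentiableAt_of_smooth hU hsf hz
  have dg := differentiableAt_of_smooth hU hsg hz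
  refine ⟨fderiv_eq_zero_of_wirtinger ?_ ?_, ?_⟩
  · rw [dz_div dg df (hf0 z hz), dz_eq_logDz_mul (hf0 z hz), dz_eq_logDz_mul (hg0 z hz), hq.2]
    ring
  · rw [dzbar_div dg df (hf0 z hz), dzbar_eq_logDzbar_mul (hf0 z hz),
      dzbar_eq_logDzbar_mul (hg0 z hz), hq.1]
    ring
  · have h := hKK z hz
    rw [Complex.mul_conj, Complex.mul_conj, Complex.normSq_eq_norm_sq,
      Complex.normSq_eq_norm_sq] at h
    have h2 : ‖hopfian g z‖ ^ 2 = ‖hopfian f z‖ ^ 2 := by exact_mod_cast h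
    rw [sq_eq_sq₀ (norm_nonneg _) (norm_nonneg _)] at h2
    rw [norm_div, h2, div_self (norm_ne_zero_iff.2 (hf0 z hz))]

end Invariants

/-! ### Change of coordinate -/

section ChangeOfCoordinate

open scoped ComplexConjugate

variable {f g : ℂ → E4} {φ : ℂ → ℂ} {U W : Set ℂ} {w : ℂ}

/-- `g` is obtained from `f` by the change of coordinate `z = φ(w)`. -/
structure IsCoordChange (f g : ℂ → E4) (φ : ℂ → ℂ) (U W : Set ℂ) : Prop where
  isOpen : IsOpen W
  mapsTo : Set.MapsTo φ W U
  holo : DifferentiableOn ℂ φ W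
  deriv_ne : ∀ w ∈ W, deriv φ w ≠ 0
  eq_comp : ∀ w ∈ W, g w = f (φ w)

theorem IsCoordChange.differentiableAt (h : IsCoordChange f g φ U W) (hw : w ∈ W) :
    DifferentiableAt ℂ φ w :=
  h.holo.differentiableAt (h.isOpen.mem_nhds hw)

theorem IsCoordChange.holo_deriv (h : IsCoordChange f g φ U W) :
    DifferentiableOn ℂ (deriv φ) W :=
  h.holo.deriv h.isOpen

/-- The factor `1 / |φ'|`. -/
noncomputable def changeScale (φ : ℂ → ℂ) (w : ℂ) : ℂ := ((‖deriv φ w‖⁻¹ : ℝ) : ℂ)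

theorem IsCoordChange.smooth_deriv (h : IsCoordChange f g φ U W) :
    ContDiffOn ℝ ∞ (deriv φ) W :=
  smooth_of_holomorphic h.isOpen h.holo_deriv

theorem IsCoordChange.smooth_changeScale (h : IsCoordChange f g φ U W) :
    ContDiffOn ℝ ∞ (changeScale φ) W :=
  smooth_ofReal ((h.smooth_deriv.norm ℝ h.deriv_ne).inv
    fun w hw => norm_ne_zero_iff.2 (h.deriv_ne w hw))

theorem IsCoordChange.changeScale_sq (h : IsCoordChange f g φ U W) (hw : w ∈ W) :
    changeScale φ w * changeScale φ w * (deriv φ w * conj (deriv φ w)) = 1 := by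
  have h0 : (‖deriv φ w‖ : ℂ) ≠ 0 := by
    exact_mod_cast norm_ne_zero_iff.2 (h.deriv_ne w hw)
  rw [Complex.mul_conj, Complex.normSq_eq_norm_sq, changeScale]
  push_cast
  field_simp

theorem changeScale_ne_zero (h0 : deriv φ w ≠ 0) : changeScale φ w ≠ 0 := by
  simp [changeScale, h0]

theorem conj_changeScale (φ : ℂ → ℂ) (w : ℂ) : conj (changeScale φ w) = changeScale φ w :=
  Complex.conj_ofReal _

theorem IsCoordChange.canonicalLift_eq (h : IsCoordChange f g φ U W) (hf : IsConformalChart f U)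
    (hw : w ∈ W) : canonicalLift g w = changeScale φ w • canonicalLift f (φ w) := by
  have e1 : fderiv ℝ g w 1 = fderiv ℝ f (φ w) (deriv φ w) := by
    have : g =ᶠ[nhds w] fun x => f (φ x) :=
      Filter.eventuallyEq_of_mem (h.isOpen.mem_nhds hw) h.eq_comp
    rw [this.fderiv_eq, fderiv_comp_holomorphic (h.differentiableAt hw)
      (differentiableAt_of_smooth hf.isOpen hf.smooth (h.mapsTo hw)), mul_one]
  funext i
  simp only [canonicalLift, changeScale, e1, hf.norm_fderiv (h.mapsTo hw) (deriv φ w),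
    h.eq_comp w hw, Pi.smul_apply, smul_eq_mul]
  rw [mul_inv]
  push_cast
  ring

theorem IsCoordChange.smooth_comp (h : IsCoordChange f g φ U W) {F : Type*}
    [NormedAddCommGroup F] [NormedSpace ℝ F] {k : ℂ → F} (hk : ContDiffOn ℝ ∞ k U) :
    ContDiffOn ℝ ∞ (fun x => k (φ x)) W :=
  hk.comp (smooth_of_holomorphic h.isOpen h.holo) h.mapsTo

theorem IsCoordChange.vdz_smul (h : IsCoordChange f g φ U W) (hU : IsOpen U) {c : ℂ → ℂ}
    {H : ℂ → Fin 5 → ℂ} (hc : ContDiffOn ℝ ∞ c W) (hH : VSmooth H U) (hw : w ∈ W) :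
    vdz (fun x => c x • H (φ x)) w
      = dz c w • H (φ w) + (c w * deriv φ w) • vdz H (φ w) := by
  funext i
  simp only [vdz, Pi.smul_apply, Pi.add_apply, smul_eq_mul]
  rw [dz_mul (differentiableAt_of_smooth h.isOpen hc hw)
    (differentiableAt_of_smooth h.isOpen (h.smooth_comp (hH i)) hw),
    dz_comp (g := fun x => H x i) (h.differentiableAt hw)
      (differentiableAt_of_smooth hU (hH i) (h.mapsTo hw))]
  ring

theorem IsCoordChange.vdzbar_smul (h : IsCoordChange f g φ U W) (hU : IsOpen U) {c : ℂ → ℂ}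
    {H : ℂ → Fin 5 → ℂ} (hc : ContDiffOn ℝ ∞ c W) (hH : VSmooth H U) (hw : w ∈ W) :
    vdzbar (fun x => c x • H (φ x)) w
      = dzbar c w • H (φ w) + (c w * conj (deriv φ w)) • vdzbar H (φ w) := by
  funext i
  simp only [vdzbar, Pi.smul_apply, Pi.add_apply, smul_eq_mul]
  rw [dzbar_mul (differentiableAt_of_smooth h.isOpen hc hw)
    (differentiableAt_of_smooth h.isOpen (h.smooth_comp (hH i)) hw),
    dzbar_comp (g := fun x => H x i) (h.differentiableAt hw)
      (differentiableAt_of_smooth hU (hH i) (h.mapsTo hw))]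
  ring

theorem IsCoordChange.smooth_smul (h : IsCoordChange f g φ U W) {c : ℂ → ℂ}
    {H : ℂ → Fin 5 → ℂ} (hc : ContDiffOn ℝ ∞ c W) (hH : VSmooth H U) :
    VSmooth (fun x => c x • H (φ x)) W :=
  fun i => hc.mul (h.smooth_comp (hH i))

theorem vdz_add {G H : ℂ → Fin 5 → ℂ} (hU : IsOpen U) (hG : VSmooth G U) (hH : VSmooth H U)
    (hw : w ∈ U) : vdz (fun x => G x + H x) w = vdz G w + vdz H w :=
  funext fun i => dz_add (differentiableAt_of_smooth hU (hG i) hw)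
    (differentiableAt_of_smooth hU (hH i) hw)

theorem vdzbar_add {G H : ℂ → Fin 5 → ℂ} (hU : IsOpen U) (hG : VSmooth G U) (hH : VSmooth H U)
    (hw : w ∈ U) : vdzbar (fun x => G x + H x) w = vdzbar G w + vdzbar H w :=
  funext fun i => dzbar_add (differentiableAt_of_smooth hU (hG i) hw)
    (differentiableAt_of_smooth hU (hH i) hw)

theorem IsCoordChange.liftZ_eq (h : IsCoordChange f g φ U W) (hf : IsConformalChart f U)
    (hw : w ∈ W) : liftZ g w = dz (changeScale φ) w • canonicalLift f (φ w)
      + (changeScale φ w * deriv φ w) • liftZ f (φ w) := by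
  rw [liftZ, vdz_congr_on h.isOpen (fun x hx => h.canonicalLift_eq hf hx) hw,
    h.vdz_smul hf.isOpen h.smooth_changeScale hf.smooth_lift hw, liftZ]

theorem IsCoordChange.liftZbar_eq (h : IsCoordChange f g φ U W) (hf : IsConformalChart f U)
    (hw : w ∈ W) : liftZbar g w = dzbar (changeScale φ) w • canonicalLift f (φ w)
      + (changeScale φ w * conj (deriv φ w)) • liftZbar f (φ w) := by
  rw [liftZbar, vdzbar_congr_on h.isOpen (fun x hx => h.canonicalLift_eq hf hx) hw,
    h.vdzbar_smul hf.isOpen h.smooth_changeScale hf.smooth_lift hw, liftZbar]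

/-- The lower coefficients `a`, `b` stay unspecified because the frames are related by a triangular
matrix, whose determinant sees only the diagonal. -/
theorem IsCoordChange.liftZZ_eq (h : IsCoordChange f g φ U W) (hf : IsConformalChart f U)
    (hw : w ∈ W) : ∃ a b : ℂ, liftZZ g w = a • canonicalLift f (φ w) + b • liftZ f (φ w)
      + (changeScale φ w * deriv φ w * deriv φ w) • liftZZ f (φ w) := by
  have s1 := smooth_dz h.isOpen h.smooth_changeScale
  have s2 := h.smooth_changeScale.mul h.smooth_deriv
  have e : liftZZ g w = (dz (dz (changeScale φ)) w • canonicalLift f (φ w)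
      + (dz (changeScale φ) w * deriv φ w) • liftZ f (φ w))
      + (dz (fun x => changeScale φ x * deriv φ x) w • liftZ f (φ w)
      + (changeScale φ w * deriv φ w * deriv φ w) • liftZZ f (φ w)) := by
    rw [liftZZ, vdz_congr_on h.isOpen (fun x hx => h.liftZ_eq hf hx) hw,
      vdz_add h.isOpen (h.smooth_smul s1 hf.smooth_lift) (h.smooth_smul s2 hf.smooth_liftZ) hw,
      h.vdz_smul hf.isOpen s1 hf.smooth_lift hw, h.vdz_smul hf.isOpen s2 hf.smooth_liftZ hw]
    rfl
  exact ⟨_, _, e.trans (by rw [add_assoc, ← add_assoc (_ • liftZ f _), ← add_smul, ← add_assoc])⟩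

theorem IsCoordChange.liftZZbar_eq (h : IsCoordChange f g φ U W) (hf : IsConformalChart f U)
    (hw : w ∈ W) : ∃ a b c : ℂ, liftZZbar g w = a • canonicalLift f (φ w) + b • liftZ f (φ w)
      + c • liftZbar f (φ w)
      + (changeScale φ w * deriv φ w * conj (deriv φ w)) • liftZZbar f (φ w) := by
  have s1 := smooth_dz h.isOpen h.smooth_changeScale
  have s2 := h.smooth_changeScale.mul h.smooth_deriv
  have e : liftZZbar g w = (dzbar (dz (changeScale φ)) w • canonicalLift f (φ w)
      + (dz (changeScale φ) w * conj (deriv φ w)) • liftZbar f (φ w))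
      + (dzbar (fun x => changeScale φ x * deriv φ x) w • liftZ f (φ w)
      + (changeScale φ w * deriv φ w * conj (deriv φ w)) • liftZZbar f (φ w)) := by
    rw [liftZZbar, vdzbar_congr_on h.isOpen (fun x hx => h.liftZ_eq hf hx) hw,
      vdzbar_add h.isOpen (h.smooth_smul s1 hf.smooth_lift) (h.smooth_smul s2 hf.smooth_liftZ) hw,
      h.vdzbar_smul hf.isOpen s1 hf.smooth_lift hw,
      h.vdzbar_smul hf.isOpen s2 hf.smooth_liftZ hw]
    rfl
  exact ⟨_, _, _, e.trans (by abel)⟩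

/-- The Hopfian is a differential of type `(3/2, -1/2)`. -/
theorem IsCoordChange.hopfian_eq (h : IsCoordChange f g φ U W) (hf : IsConformalChart f U)
    (hw : w ∈ W) : hopfian g w
      = changeScale φ w * (deriv φ w * deriv φ w) * hopfian f (φ w) := by
  obtain ⟨a, b, e1⟩ := h.liftZZ_eq hf hw
  obtain ⟨a', b', c', e2⟩ := h.liftZZbar_eq hf hw
  have hs := h.changeScale_sq hw
  rw [hopfian_eq_normalPart, hopfian_eq_normalPart, normalPart, normalPart,
    h.canonicalLift_eq hf hw, h.liftZ_eq hf hw, h.liftZbar_eq hf hw, e1, e2]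
  generalize changeScale φ w = t at *
  generalize deriv φ w = d at *
  generalize dz (changeScale φ) w = p
  generalize dzbar (changeScale φ) w = q
  rw [frameDet_eq_of_combination (a := canonicalLift f (φ w)) (b := liftZ f (φ w))
    (c := liftZbar f (φ w)) (d := liftZZbar f (φ w)) (v := liftZZ f (φ w))
    !![t, 0, 0, 0, 0; p, t * d, 0, 0, 0; q, 0, t * conj d, 0, 0;
      a', b', c', t * d * conj d, 0; a, b, 0, 0, t * d * d]]
  -- The diagonal product is `t⁵ d⁴ d̄²`; using `t² d d̄ = 1` twice reduces it to `t d²`.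
  · rw [Matrix.det_of_isLowerTriangular]
    · simp only [Fin.prod_univ_five]
      simp
      linear_combination (4 * Complex.I * t * d * d * frameDet (canonicalLift f (φ w))
        (liftZ f (φ w)) (liftZbar f (φ w)) (liftZZbar f (φ w)) (liftZZ f (φ w)))
        * (t * t * (d * conj d) + 1) * hs
    · intro i j hij
      fin_cases i <;> fin_cases j <;> first | rfl | exact absurd hij (by decide)
  · intro i j
    fin_cases i <;> simp [Fin.sum_univ_succ] <;> try ring

/-- The function `𝒫` does not depend on the coordinate. -/
theorem IsCoordChange.coordP_eq (h : IsCoordChange f g φ U W) (hf : IsConformalChart f U)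
    (hg : IsConformalChart g W) (hf0 : ∀ z ∈ U, hopfian f z ≠ 0)
    (hg0 : ∀ x ∈ W, hopfian g x ≠ 0) (hw : w ∈ W) : coordP g w = coordP f (φ w) := by
  have hsd := h.smooth_deriv
  have hst := h.smooth_changeScale
  have hsφ := h.smooth_comp hf.smooth_hopfian
  have hsq := smooth_logDzbar hf.isOpen hf.smooth_hopfian hf0
  have hd : ∀ x ∈ W, DifferentiableAt ℂ (deriv φ) x :=
    fun x hx => h.holo_deriv.differentiableAt (h.isOpen.mem_nhds hx)
  have hdd : ∀ x ∈ W, DifferentiableAt ℂ (deriv (deriv φ)) x :=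
    fun x hx => (h.holo_deriv.deriv h.isOpen).differentiableAt (h.isOpen.mem_nhds hx)
  -- the logarithmic derivative of the scale factor is antiholomorphic
  have e1 : ∀ x ∈ W, dzbar (changeScale φ) x
      = (-1 / 2) * conj (deriv (deriv φ) x / deriv φ x) * changeScale φ x := by
    intro x hx
    have dt := differentiableAt_of_smooth h.isOpen hst hx
    have dd := differentiableAt_of_smooth h.isOpen hsd hx
    have ddc := differentiableAt_of_smooth h.isOpen (smooth_conj hsd) hx
    have h1 := dzbar_congr_on h.isOpen (fun y hy => h.changeScale_sq hy) hx
    rw [dzbar_mul (dt.fun_mul dt) (dd.fun_mul ddc), dzbar_mul dt dt, dzbar_mul dd ddc,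
      dzbar_conj dd, dzbar_holomorphic (hd x hx), dz_holomorphic (hd x hx), dzbar_const] at h1
    have hc : conj (deriv φ x) ≠ 0 := by simpa using h.deriv_ne x hx
    have ht := changeScale_ne_zero (h.deriv_ne x hx)
    rw [map_div₀]
    field_simp
    apply mul_left_cancel₀ (mul_ne_zero ht (h.deriv_ne x hx))
    linear_combination h1
  have e2 : ∀ x ∈ W, logDzbar (hopfian g) x
      = (-1 / 2) * conj (deriv (deriv φ) x / deriv φ x)
        + conj (deriv φ x) * logDzbar (hopfian f) (φ x) := by
    intro x hx
    have dt := differentiableAt_of_smooth h.isOpen hst hx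
    have dd := differentiableAt_of_smooth h.isOpen hsd hx
    have dk := differentiableAt_of_smooth h.isOpen hsφ hx
    have hk := hf0 _ (h.mapsTo hx)
    have ht := changeScale_ne_zero (h.deriv_ne x hx)
    have hd0 := h.deriv_ne x hx
    rw [logDzbar, dzbar_congr_on h.isOpen (fun y hy => h.hopfian_eq hf hy) hx,
      dzbar_mul (dt.fun_mul (dd.fun_mul dd)) dk, dzbar_mul dt (dd.fun_mul dd), dzbar_mul dd dd,
      dzbar_holomorphic (hd x hx), dzbar_comp (h.differentiableAt hx)
        (differentiableAt_of_smooth hf.isOpen hf.smooth_hopfian (h.mapsTo hx)), e1 x hx,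
      h.hopfian_eq hf hx, logDzbar]
    generalize conj (deriv (deriv φ) x / deriv φ x) = r
    field_simp
    ring
  -- The inhomogeneous term of `e2` is antiholomorphic, so `∂_z` kills it. Thus `q_z` scales by
  -- `|φ'|²`, exactly as `|κ|²` does in `e4`, and the quotient is invariant.
  have e3 : dz (logDzbar (hopfian g)) w
      = deriv φ w * conj (deriv φ w) * dz (logDzbar (hopfian f)) (φ w) := by
    have hh : DifferentiableAt ℂ (fun x => deriv (deriv φ) x / deriv φ x) w :=
      (hdd w hw).fun_div (hd w hw) (h.deriv_ne w hw)
    have hhr : DifferentiableAt ℝ (fun x => deriv (deriv φ) x / deriv φ x) w :=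
      hh.restrictScalars ℝ
    have hhc : DifferentiableAt ℝ (fun x => conj (deriv (deriv φ) x / deriv φ x)) w :=
      Complex.conjCLE.toContinuousLinearMap.differentiableAt.comp w hhr
    have dd := differentiableAt_of_smooth h.isOpen hsd hw
    have ddc := differentiableAt_of_smooth h.isOpen (smooth_conj hsd) hw
    have dq := differentiableAt_of_smooth h.isOpen (h.smooth_comp hsq) hw
    rw [dz_congr_on h.isOpen e2 hw, dz_add (hhc.const_mul _) (ddc.fun_mul dq),
      dz_const_mul _ hhc, dz_conj hhr, dzbar_holomorphic hh, dz_mul ddc dq, dz_conj dd,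
      dzbar_holomorphic (hd w hw), dz_comp (h.differentiableAt hw)
        (differentiableAt_of_smooth hf.isOpen hsq (h.mapsTo hw))]
    simp
    ring
  have e4 : hopfian g w * conj (hopfian g w) = deriv φ w * conj (deriv φ w)
      * (hopfian f (φ w) * conj (hopfian f (φ w))) := by
    rw [h.hopfian_eq hf hw]
    simp only [map_mul, conj_changeScale]
    linear_combination (deriv φ w * conj (deriv φ w)
      * (hopfian f (φ w) * conj (hopfian f (φ w)))) * h.changeScale_sq hw
  rw [coordP, coordP, hf.rho_eq hf0 (h.mapsTo hw), hg.rho_eq hg0 hw, e3, e4]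
  have n1 := mul_conj_ne_zero (hf0 _ (h.mapsTo hw))
  have n2 := mul_conj_ne_zero (h.deriv_ne w hw)
  generalize deriv φ w * conj (deriv φ w) = r at *
  generalize hopfian f (φ w) * conj (hopfian f (φ w)) = m at *
  field_simp

/-- The transformation factor of the Hopfian depends on `φ` alone and cancels. This makes the ratio
of the Hopfians a function on the surface. -/
theorem IsCoordChange.hopfian_ratio_eq {f' g' : ℂ → E4} (h : IsCoordChange f g φ U W)
    (h' : IsCoordChange f' g' φ U W) (hf : IsConformalChart f U) (hf' : IsConformalChart f' U)
    (hw : w ∈ W) :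
    hopfian g' w / hopfian g w = hopfian f' (φ w) / hopfian f (φ w) := by
  have hd := h.deriv_ne w hw
  rw [h.hopfian_eq hf hw, h'.hopfian_eq hf' hw,
    mul_div_mul_left _ _ (mul_ne_zero (changeScale_ne_zero hd) (mul_ne_zero hd hd))]

end ChangeOfCoordinate

/-! ### Surfaces -/

section Surfaces

open scoped ComplexConjugate

variable {M : Type*} [TopologicalSpace M] [ChartedSpace ℂ M] {y y' : M → S3}
  {e e' : OpenPartialHomeomorph M ℂ}

theorem IsConformalImmersion.isConformalChart (hy : IsConformalImmersion y)
    (he : e ∈ holoCharts M) : IsConformalChart (inCoord y e) e.target where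
  isOpen := e.open_target
  smooth := hy.smooth e he
  norm_eq z := by simp [inCoord]
  conformal := hy.conformal e he

theorem differentiableOn_transition (he : e ∈ holoCharts M) (he' : e' ∈ holoCharts M) :
    DifferentiableOn ℂ (e.symm.trans e') (e.symm.trans e').source := by
  have h1 := IsManifold.compatible_of_mem_maximalAtlas he he'
  rw [contDiffGroupoid, mem_groupoid_of_pregroupoid] at h1
  have h2 : ContDiffOn ℂ ω (e.symm.trans e') (e.symm.trans e').source := by
    simpa [contDiffPregroupoid] using h1.1
  exact h2.differentiableOn (by simp)

theorem deriv_transition_ne_zero (he : e ∈ holoCharts M) (he' : e' ∈ holoCharts M) {z : ℂ}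
    (hz : z ∈ (e.symm.trans e').source) : deriv (e.symm.trans e') z ≠ 0 := by
  have d1 : DifferentiableAt ℂ (e.symm.trans e') z :=
    (differentiableOn_transition he he').differentiableAt
      ((e.symm.trans e').open_source.mem_nhds hz)
  have hz' : e.symm.trans e' z ∈ (e'.symm.trans e).source := by
    simp at hz ⊢
    simp [hz]
  have d2 : DifferentiableAt ℂ (e'.symm.trans e) (e.symm.trans e' z) :=
    (differentiableOn_transition he' he).differentiableAt
      ((e'.symm.trans e).open_source.mem_nhds hz')
  have hid : (fun w => e'.symm.trans e (e.symm.trans e' w)) =ᶠ[nhds z] fun w => w := by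
    refine Filter.eventuallyEq_of_mem ((e.symm.trans e').open_source.mem_nhds hz) fun w hw => ?_
    simp at hw ⊢
    simp [hw]
  have h := (d2.hasDerivAt.comp z d1.hasDerivAt).deriv
  rw [show (e'.symm.trans e) ∘ (e.symm.trans e')
    = fun w => e'.symm.trans e (e.symm.trans e' w) from rfl, hid.deriv_eq] at h
  intro h0
  rw [h0] at h
  simp at h

theorem isCoordChange_transition (y : M → S3) (he : e ∈ holoCharts M) (he' : e' ∈ holoCharts M) :
    IsCoordChange (inCoord y e') (inCoord y e) (e.symm.trans e') e'.target
      (e.symm.trans e').source where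
  isOpen := (e.symm.trans e').open_source
  mapsTo w hw := by simp at hw; simp [hw]
  holo := differentiableOn_transition he he'
  deriv_ne w hw := deriv_transition_ne_zero he he' hw
  eq_comp w hw := by simp at hw; simp [inCoord, hw]

theorem IsConformalChart.mono {f : ℂ → E4} {U V : Set ℂ} (hf : IsConformalChart f U)
    (hV : IsOpen V) (hVU : V ⊆ U) : IsConformalChart f V where
  isOpen := hV
  smooth := hf.smooth.mono hVU
  norm_eq := hf.norm_eq
  conformal z hz := hf.conformal z (hVU hz)

theorem coordP_eq_of_mem (hy : IsConformalImmersion y) (hU : UmbilicFree y)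
    (he : e ∈ holoCharts M) (he' : e' ∈ holoCharts M) {p : M} (hp : p ∈ e.source)
    (hp' : p ∈ e'.source) : coordP (inCoord y e) (e p) = coordP (inCoord y e') (e' p) := by
  have hsub : (e.symm.trans e').source ⊆ e.target := by
    intro w hw; simp at hw; exact hw.1
  have h := (isCoordChange_transition y he he').coordP_eq (w := e p) (hy.isConformalChart he')
    ((hy.isConformalChart he).mono (e.symm.trans e').open_source hsub)
    (hU e' he') (fun x hx => hU e he x (hsub hx)) (by simp [hp, hp'])
  rw [h]
  simp [hp]

theorem hopfian_ratio_eq_of_mem (hy : IsConformalImmersion y) (hy' : IsConformalImmersion y')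
    (he : e ∈ holoCharts M) (he' : e' ∈ holoCharts M) {p : M} (hp : p ∈ e.source)
    (hp' : p ∈ e'.source) :
    hopfian (inCoord y' e) (e p) / hopfian (inCoord y e) (e p)
      = hopfian (inCoord y' e') (e' p) / hopfian (inCoord y e') (e' p) := by
  have h := (isCoordChange_transition y he he').hopfian_ratio_eq (w := e p)
    (isCoordChange_transition y' he he') (hy.isConformalChart he')
    (hy'.isConformalChart he') (by simp [hp, hp'])
  rw [h]
  simp [hp]

/-- Hopfians that differ by a constant phase determine the same Schwarzian. -/
theorem HopfiansDifferByPhase.sameAssociatedFamily (hU : UmbilicFree y) (hW : IsWillmore y)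
    (hW' : IsWillmore y') (hy : IsConformalImmersion y)
    (h : HopfiansDifferByPhase y y') : SameAssociatedFamily y y' := by
  obtain ⟨t, ht⟩ := h
  refine ⟨t, fun e he z hz => ⟨?_, ht e he z hz⟩⟩
  have hf := hy.isConformalChart he
  have hs := smooth_dzbar hf.isOpen hf.smooth_hopfian
  have h1 : ∀ w ∈ e.target, dzbar (hopfian (inCoord y' e)) w
      = Complex.exp (Complex.I * t) * dzbar (hopfian (inCoord y e)) w := fun w hw => by
    rw [dzbar_congr_on hf.isOpen (ht e he) hw, dzbar_const_mul _
      (differentiableAt_of_smooth hf.isOpen hf.smooth_hopfian hw)]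
  have h2 : dzbar (dzbar (hopfian (inCoord y' e))) z
      = Complex.exp (Complex.I * t) * dzbar (dzbar (hopfian (inCoord y e))) z := by
    rw [dzbar_congr_on hf.isOpen h1 hz, dzbar_const_mul _
      (differentiableAt_of_smooth hf.isOpen hs hz)]
  have w1 := hW e he z hz
  have w2 := hW' e he z hz
  rw [h2, ht e he z hz] at w2
  -- The two Willmore equations have proportional second derivatives, so they determine the same
  -- `s̄` after division by `e^{it} κ ≠ 0`.
  apply (starRingEnd ℂ).injective
  apply mul_right_cancel₀ (mul_ne_zero (Complex.exp_ne_zero (Complex.I * t)) (hU e he z hz))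
  linear_combination 2 * w2 - 2 * Complex.exp (Complex.I * t) * w1

/-- `𝒫` depends on `κ` only through `κ_z̄/κ` and `|κ|²`, and a constant phase changes neither. -/
theorem HopfiansDifferByPhase.coordP_eq (hy : IsConformalImmersion y)
    (hy' : IsConformalImmersion y') (hU : UmbilicFree y) (hU' : UmbilicFree y')
    (h : HopfiansDifferByPhase y y') (he : e ∈ holoCharts M) {z : ℂ} (hz : z ∈ e.target) :
    coordP (inCoord y e) z = coordP (inCoord y' e) z := by
  obtain ⟨t, ht⟩ := h
  have hf := hy.isConformalChart he
  have hf' := hy'.isConformalChart he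
  have hexp : Complex.exp (Complex.I * t) * conj (Complex.exp (Complex.I * t)) = 1 := by
    rw [Complex.mul_conj, Complex.normSq_eq_norm_sq, mul_comm, Complex.norm_exp_ofReal_mul_I]
    simp
  have h1 : ∀ w ∈ e.target, logDzbar (hopfian (inCoord y' e)) w
      = logDzbar (hopfian (inCoord y e)) w := fun w hw => by
    rw [logDzbar, dzbar_congr_on hf.isOpen (ht e he) hw, dzbar_const_mul _
      (differentiableAt_of_smooth hf.isOpen hf.smooth_hopfian hw), ht e he w hw, logDzbar,
      mul_div_mul_left _ _ (Complex.exp_ne_zero _)]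
  have h2 : hopfian (inCoord y' e) z * conj (hopfian (inCoord y' e) z)
      = hopfian (inCoord y e) z * conj (hopfian (inCoord y e) z) := by
    rw [ht e he z hz, map_mul]
    linear_combination (hopfian (inCoord y e) z * conj (hopfian (inCoord y e) z)) * hexp
  rw [coordP, coordP, hf.rho_eq (hU e he) hz, hf'.rho_eq (hU' e he) hz, h2,
    dz_congr_on hf.isOpen h1 hz]

/-! ### From coordinates to functions on the surface -/

variable [IsManifold 𝓘(ℂ) ω M]

theorem chartAt_mem_holoCharts (p : M) : chartAt ℂ p ∈ holoCharts M :=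
  IsManifold.chart_mem_maximalAtlas p

/-- The ratio of the Hopfians, a function on `M`. -/
noncomputable def hopfianRatio (y y' : M → S3) (p : M) : ℂ :=
  hopfian (inCoord y' (chartAt ℂ p)) (chartAt ℂ p p)
    / hopfian (inCoord y (chartAt ℂ p)) (chartAt ℂ p p)

theorem hopfianRatio_eq (hy : IsConformalImmersion y) (hy' : IsConformalImmersion y')
    (he : e ∈ holoCharts M) {p : M} (hp : p ∈ e.source) :
    hopfianRatio y y' p = hopfian (inCoord y' e) (e p) / hopfian (inCoord y e) (e p) :=
  hopfian_ratio_eq_of_mem hy hy' (chartAt_mem_holoCharts p) he (mem_chart_source ℂ p) hp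

theorem invP_eq_coordP (hy : IsConformalImmersion y) (hU : UmbilicFree y)
    (he : e ∈ holoCharts M) {p : M} (hp : p ∈ e.source) :
    invP y p = coordP (inCoord y e) (e p) :=
  coordP_eq_of_mem hy hU (chartAt_mem_holoCharts p) he (mem_chart_source ℂ p) hp

theorem moebiusCurvature_eq (hy : IsConformalImmersion y) (hU : UmbilicFree y) (p : M) :
    moebiusCurvature y p = 1 + (invP y p).re / 2 :=
  (hy.isConformalChart (chartAt_mem_holoCharts p)).coordK_eq (hU _ (chartAt_mem_holoCharts p))
    (mem_chart_target ℂ p)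

theorem hopfiansDifferByPhase_of_invP_eq [ConnectedSpace M] (hy : IsConformalImmersion y)
    (hy' : IsConformalImmersion y') (hU : UmbilicFree y) (hU' : UmbilicFree y')
    (hW : IsWillmore y) (hW' : IsWillmore y') (hP : ∀ p, invP y p ≠ 0)
    (hK : ∀ p, moebiusCurvature y p ≠ 0) (h : invP y = invP y') :
    HopfiansDifferByPhase y y' := by
  have local_ratio : ∀ e ∈ holoCharts M, ∀ z ∈ e.target,
      fderiv ℝ (fun w => hopfian (inCoord y' e) w / hopfian (inCoord y e) w) z = 0 ∧
      ‖hopfian (inCoord y' e) z / hopfian (inCoord y e) z‖ = 1 := by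
    intro e he z hz
    have hPe : ∀ w ∈ e.target, invP y (e.symm w) = coordP (inCoord y e) w := fun w hw => by
      rw [invP_eq_coordP hy hU he (e.map_target hw), e.right_inv hw]
    have hPe' : ∀ w ∈ e.target, invP y' (e.symm w) = coordP (inCoord y' e) w := fun w hw => by
      rw [invP_eq_coordP hy' hU' he (e.map_target hw), e.right_inv hw]
    refine (hy.isConformalChart he).hopfian_ratio (hy'.isConformalChart he) (hU e he) (hU' e he)
      (hW e he) (hW' e he) (fun w hw => ?_) (fun w hw => ?_) (fun w hw => ?_) hz
    · rw [← hPe w hw, ← hPe' w hw, h]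
    · rw [← hPe w hw]; exact hP _
    · rw [(hy.isConformalChart he).coordK_eq (hU e he) hw, ← hPe w hw,
        ← moebiusCurvature_eq hy hU]
      exact hK _
  have hloc : IsLocallyConstant (hopfianRatio y y') := by
    rw [IsLocallyConstant.iff_eventually_eq]
    intro p
    set e := chartAt ℂ p with he_def
    have he : e ∈ holoCharts M := chartAt_mem_holoCharts p
    have hp : p ∈ e.source := mem_chart_source ℂ p
    -- A ball inside the coordinate domain is connected, so a vanishing derivative makes the ratio
    -- constant on it.
    obtain ⟨r, hr, hball⟩ := Metric.isOpen_iff.1 e.open_target (e p) (e.map_source hp)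
    have hf := hy.isConformalChart he
    have hf' := hy'.isConformalChart he
    have hd := smooth_div hf'.smooth_hopfian hf.smooth_hopfian (hU e he)
    have hnear : ∀ᶠ q in nhds p, e q ∈ Metric.ball (e p) r :=
      (e.continuousAt hp).eventually (Metric.ball_mem_nhds _ hr)
    filter_upwards [hnear, e.open_source.mem_nhds hp] with q hq hqs
    rw [hopfianRatio_eq hy hy' he hqs, hopfianRatio_eq hy hy' he hp]
    exact Metric.isOpen_ball.is_const_of_fderiv_eq_zero (𝕜 := ℝ)
      (f := fun w => hopfian (inCoord y' e) w / hopfian (inCoord y e) w)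
      (convex_ball _ _).isPreconnected
      (fun w hw => (differentiableAt_of_smooth hf.isOpen hd (hball hw)).differentiableWithinAt)
      (fun w hw => (local_ratio e he w (hball hw)).1) hq (Metric.mem_ball_self hr)
  obtain ⟨p₀⟩ := (inferInstance : Nonempty M)
  have hconst : ∀ p, hopfianRatio y y' p = hopfianRatio y y' p₀ :=
    fun p => hloc.apply_eq_of_isPreconnected isPreconnected_univ (Set.mem_univ p) (Set.mem_univ p₀)
  have hnorm : ‖hopfianRatio y y' p₀‖ = 1 :=
    (local_ratio _ (chartAt_mem_holoCharts p₀) _ (mem_chart_target ℂ p₀)).2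
  -- The constant ratio has modulus one, so it is `e^{it}` with `t` its argument.
  refine ⟨Complex.arg (hopfianRatio y y' p₀), fun e he z hz => ?_⟩
  have h1 := hopfianRatio_eq hy hy' he (e.map_target hz)
  rw [e.right_inv hz, hconst, ← Complex.norm_mul_exp_arg_mul_I (hopfianRatio y y' p₀), hnorm] at h1
  rw [mul_comm Complex.I]
  have h0 := hU e he z hz
  field_simp at h1
  simpa [mul_comm] using h1.symm

end Surfaces

end WillmoreS3

/-! ### The proposition -/

theorem mainTheorem7 {M : Type*} [TopologicalSpace M] [T2Space M] [ConnectedSpace M]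
    [ChartedSpace ℂ M] [IsManifold 𝓘(ℂ) ω M] (y y' : M → WillmoreS3.S3)
    (hy : WillmoreS3.IsConformalImmersion y) (hy' : WillmoreS3.IsConformalImmersion y')
    (hU : WillmoreS3.UmbilicFree y) (hU' : WillmoreS3.UmbilicFree y')
    (hW : WillmoreS3.IsWillmore y) (hW' : WillmoreS3.IsWillmore y')
    (hP : ∀ p, WillmoreS3.invP y p ≠ 0) (hK : ∀ p, WillmoreS3.moebiusCurvature y p ≠ 0) :
    (WillmoreS3.invP y = WillmoreS3.invP y' ↔ WillmoreS3.SameAssociatedFamily y y') ∧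
    (WillmoreS3.SameAssociatedFamily y y' ↔ WillmoreS3.HopfiansDifferByPhase y y') := by
  have h2 : WillmoreS3.SameAssociatedFamily y y' ↔ WillmoreS3.HopfiansDifferByPhase y y' :=
    ⟨fun ⟨t, ht⟩ => ⟨t, fun e he z hz => (ht e he z hz).2⟩,
      fun h => h.sameAssociatedFamily hU hW hW' hy⟩
  refine ⟨⟨fun h => h2.2 ?_, fun h => funext fun p => ?_⟩, h2⟩
  · exact WillmoreS3.hopfiansDifferByPhase_of_invP_eq hy hy' hU hU' hW hW' hP hK h
  · exact (h2.1 h).coordP_eq hy hy' hU hU' (WillmoreS3.chartAt_mem_holoCharts p)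
      (mem_chart_target ℂ p)
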